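/- **Conventions.** Let $\mathbb R^{n-1,1}$ carry $\eta=\mathrm{diag}(-1,1,\dots,1)$ with coordinates $0,\dots,n-1$, let $\mathrm{Spin}(n-1,1)$ be the (connected) spin group inside the Clifford algebra with $\Gamma_a\Gamma_b+\Gamma_b\Gamma_a=2\eta_{ab}$, and let $\mathrm{Spin}(5,1)\times\mathrm{Spin}(4)\to\mathrm{Spin}(9,1)\to\mathrm{Spin}(10,1)$ and $\mathrm{Spin}(3,1)\times\mathrm{Spin}(2)\to\mathrm{Spin}(5,1)$ be the homomorphisms given by the coordinates $(0..5\,|\,6..9)$, $0..9$, and $(0..3\,|\,4,5)$. Identify $\mathrm U(1)_V\simeq\mathrm{Spin}(2)$ by $e^{i\theta}\mapsto\exp(\theta\,\Gamma_4\Gamma_5)$. Let $\tau^1=\tfrac i2\left(\begin{smallmatrix}1&0\\0&-1\end{smallmatrix}\right)$, $\tau^2=\tfrac i2\left(\begin{smallmatrix}0&-i\\i&0\end{smallmatrix}\right)$, $\tau^3=\tfrac i2\left(\begin{smallmatrix}0&1\\1&0\end{smallmatrix}\right)$ be the basis of $\mathfrak{su}(2)$, and let $\mathrm{SU}(2)_L\times\mathrm{SU}(2)_R\simeq\mathrm{Spin}(4)$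 be the isomorphism with $\tau^1\mapsto J^1_L=-\tfrac14(\Gamma_6\Gamma_7+\Gamma_8\Gamma_9)$ on the first and $\tau^1\mapsto J^1_R=\tfrac14(\Gamma_6\Gamma_7-\Gamma_8\Gamma_9)$ on the second factor, and cyclically in $7,8,9$ for $\tau^2,\tau^3$. Put $\mathbb Z_2^A=\{1,\exp(2\pi J_L^1)\}\subset\mathrm{SU}(2)_L$. Representations of these product groups are understood by restriction along the homomorphisms above, and the subspace fixed by a subgroup of $\mathrm{SU}(2)_L$ is regarded with its residual action. For $\mathbb K=\mathbb C,\mathbb H,\mathbb O$ let $\sigma(v)=\left(\begin{smallmatrix}v^0+v^1&x\\ \bar x&v^0-v^1\end{smallmatrix}\right)$, where $x$ is $v^2+v^3\mathrm i$, respectively $v^2+v^3\mathrm i+v^4\mathrm j+v^5\mathrm k$, respectively $(v^2+v^3\mathrm i+v^4\mathrm j+v^5\mathrm k)+(v^6+v^7\mathrm i+v^8\mathrm j+v^9\mathrm k)\ell$, and let $\bar\sigma(v)$ be the same with $v^0$ replaced by $-v^0$. Octonions multiply by $(q_1+p_1\ell)(q_2+p_2\ell)=(q_1q_2-\bar p_2p_1)+(p_2q_1+p_1\bar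 q_2)\ell$. Let $\mathbf 2_{\mathbb C}$ of $\mathrm{Spin}(3,1)$ on $\mathbb C^2$, $\mathbf 8$ of $\mathrm{Spin}(5,1)$ on $\mathbb H^2$ and $\mathbf{16}$ of $\mathrm{Spin}(9,1)$ on $\mathbb O^2$ be the representations with $\Gamma(u)\Gamma(v)\mapsto\bar\sigma(u)\cdot(\sigma(v)\cdot-)$, and $\overline{\mathbf 2}_{\mathbb C},\overline{\mathbf 8},\overline{\mathbf{16}}$ those with $\Gamma(u)\Gamma(v)\mapsto\sigma(u)\cdot(\bar\sigma(v)\cdot-)$. Let $\mathbf{32}$ be the representation of $\mathrm{Spin}(10,1)$ on $\mathbb O^2\oplus\mathbb O^2$ with $\Gamma(v)\mapsto\left(\begin{smallmatrix}v^{10}&\bar\sigma(v)\\ \sigma(v)&-v^{10}\end{smallmatrix}\right)$. Finally $\mathbf 1^-_{\mathbb C}$ is the irrep of $\mathrm U(1)$ of charge $-1$, $\mathbf 2_{\mathbb C}$ of $\mathrm{SU}(2)$ is the fundamental representation, $\mathbf 3$ is the adjoint action of $\mathrm{SU}(2)$ on imaginary quaternions, and $\mathbf 4$ is the vector representation of $\mathrm{Spin}(4)$,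 with basis $e_6,\dots,e_9$. **Theorem 3.1 (Fields at $\mathrm A_1$-singularity).** *(Bosons)* The $\mathrm{SU}(2)_L$-fixed subspace of $\wedge^2\mathbf 4$ is $$\Big\langle\ \tfrac12\,e_6\wedge e_I-\tfrac12\sum_{J<K}\epsilon^{IJK}e_J\wedge e_K\ \Big\rangle_{I\in\{7,8,9\}}$$ (with $\epsilon^{789}=1$), and it is isomorphic to the $\mathbf 3$ of $\mathrm{SU}(2)_R$. In $\wedge^1\mathbf 4$ and $\wedge^3\mathbf 4$ the only vector fixed by $\mathbb Z_2^A$ is $0$; hence the same holds for $\mathrm{SU}(2)_L$. *(Spinors)* The $\mathbb Z_2^A$-fixed subspaces of $\mathbf{16}$ and of $\overline{\mathbf{16}}$ are both equal to $\mathbb H^2\subset\mathbb O^2$; they are also the $\mathrm{SU}(2)_L$-fixed subspaces, and as representations of $\mathrm{Spin}(5,1)$ they are $\mathbf 8$ and $\overline{\mathbf 8}$. As real representations of $\mathrm{Spin}(3,1)\times\mathrm U(1)_V\times\mathrm{SU}(2)_R$, $$\mathbf{16}^{\mathbb Z_2^A}=\mathbf 8\;\simeq_{\mathbb R}\;\mathbf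 2_{\mathbb C}\boxtimes_{\mathbb C}\mathbf 1^-_{\mathbb C}\boxtimes_{\mathbb C}\mathbf 2_{\mathbb C},\qquad \overline{\mathbf{16}}^{\mathbb Z_2^A}=\overline{\mathbf 8}\;\simeq_{\mathbb R}\;\overline{\mathbf 2}_{\mathbb C}\boxtimes_{\mathbb C}\mathbf 1^-_{\mathbb C}\boxtimes_{\mathbb C}\mathbf 2_{\mathbb C},$$ in each case by an isomorphism that respects $\mathbb H^2=\mathbb C^2\oplus\mathbb C^2\mathrm j$: if $\varepsilon_0,\varepsilon_1$ is the standard basis of the $\mathbf 2_{\mathbb C}$ of $\mathrm{SU}(2)_R$, then $\psi\,\mathrm j\in\mathbb H^2$ corresponds to $\psi\otimes1\otimes\varepsilon_0$ and $-\psi\in\mathbb H^2$ to $\psi\otimes1\otimes\varepsilon_1$, for all $\psi\in\mathbb C^2$. Moreover the $\mathbb Z_2^A$-fixed subspace of $\mathbf{32}$ is also its $\mathrm{SU}(2)_L$-fixed subspace, and as real representations of $\mathrm{Spin}(3,1)\times\mathrm U(1)_V\times\mathrm{SU}(2)_R$ $$\mathbf{32}^{\mathbb Z_2^A}\;\simeq_{\mathbb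 R}\;(\mathbf 2_{\mathbb C}\oplus\overline{\mathbf 2}_{\mathbb C})\boxtimes_{\mathbb C}\mathbf 1^-_{\mathbb C}\boxtimes_{\mathbb C}\mathbf 2_{\mathbb C}.$$ -/

import Mathlib

open scoped TensorProduct

noncomputable section

/-! ### Spin groups -/

/-- The isometric inclusion of coordinate spaces (extension by zero) along an injection of
coordinates that preserves the signs of the coordinates. -/
def coordIsometry {m n : ℕ} (w : Fin m → ℝ) (w' : Fin n → ℝ) (e : Fin m ↪ Fin n)
    (h : ∀ i, w' (e i) = w i) :
    QuadraticMap.weightedSumSquares ℝ w →qᵢ QuadraticMap.weightedSumSquares ℝ w' where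
  toLinearMap := Function.ExtendByZero.linearMap ℝ e
  map_app' v := by
    simp only [QuadraticMap.weightedSumSquares_apply]
    rw [← Finset.sum_subset (Finset.subset_univ (Finset.univ.map e))]
    · rw [Finset.sum_map]
      refine Finset.sum_congr rfl fun i _ => ?_
      simp [h, e.injective.extend_apply]
    · intro j _ hj
      have : ¬ ∃ i, e i = j := by simpa using hj
      simp [Function.extend_apply' _ _ _ this]

section SpinMap

variable {V W : Type*} [AddCommGroup V] [Module ℝ V] [AddCommGroup W] [Module ℝ W]
  {Q : QuadraticForm ℝ V} {Q' : QuadraticForm ℝ W}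

theorem cliffordMap_star (f : Q →qᵢ Q') (x : CliffordAlgebra Q) :
    CliffordAlgebra.map f (star x) = star (CliffordAlgebra.map f x) := by
  induction x using CliffordAlgebra.induction with
  | algebraMap r => simp [CliffordAlgebra.star_def]
  | ι v => simp [CliffordAlgebra.star_def]
  | mul a b ha hb => simp only [star_mul, map_mul, ha, hb]
  | add a b ha hb => simp only [star_add, map_add, ha, hb]

theorem cliffordMap_mem_spinGroup (f : Q →qᵢ Q') {x : CliffordAlgebra Q}
    (hx : x ∈ spinGroup Q) : CliffordAlgebra.map f x ∈ spinGroup Q' := by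
  obtain ⟨⟨⟨y, hy, rfl⟩, hu⟩, he⟩ := hx
  refine ⟨⟨⟨Units.map (CliffordAlgebra.map f : _ →* _) y, ?_, rfl⟩, ?_⟩, ?_⟩
  · have : Subgroup.map (Units.map (CliffordAlgebra.map f : _ →* _)) (lipschitzGroup Q)
        ≤ lipschitzGroup Q' := by
      rw [lipschitzGroup, MonoidHom.map_closure, Subgroup.closure_le]
      rintro _ ⟨z, ⟨v, hv⟩, rfl⟩
      apply Subgroup.subset_closure
      refine ⟨f v, ?_⟩
      simp [← hv]
    exact this ⟨y, hy, rfl⟩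
  · change CliffordAlgebra.map f (y : CliffordAlgebra Q) ∈ unitary (CliffordAlgebra Q')
    replace hu : (y : CliffordAlgebra Q) ∈ unitary (CliffordAlgebra Q) := hu
    rw [Unitary.mem_iff] at hu ⊢
    rw [← cliffordMap_star, ← map_mul, ← map_mul, hu.1, hu.2, map_one]
    exact ⟨rfl, rfl⟩
  · have h0 : Subalgebra.map (CliffordAlgebra.map f) (CliffordAlgebra.even Q)
        ≤ CliffordAlgebra.even Q' := by
      rintro _ ⟨z, hz, rfl⟩
      induction z, hz using CliffordAlgebra.even_induction with
      | algebraMap r => simp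
      | add a b _ _ ha hb => rw [map_add]; exact add_mem ha hb
      | ι_mul_ι_mul u v a _ ha =>
        have h1 : CliffordAlgebra.map f (CliffordAlgebra.ι Q u * CliffordAlgebra.ι Q v * a) =
            CliffordAlgebra.ι Q' (f u) * CliffordAlgebra.ι Q' (f v) *
              CliffordAlgebra.map f a := by simp
        exact h1 ▸ mul_mem (CliffordAlgebra.ι_mul_ι_mem_evenOdd_zero Q' _ _) ha
    exact h0 ⟨_, he, rfl⟩

/-- Functoriality of `Spin` under isometric maps. -/
def spinMap (f : Q →qᵢ Q') : spinGroup Q →* spinGroup Q' where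
  toFun x := ⟨CliffordAlgebra.map f x, cliffordMap_mem_spinGroup f x.2⟩
  map_one' := Subtype.ext (map_one _)
  map_mul' x y := Subtype.ext (map_mul _ _ _)

end SpinMap

section SpinProd

variable {V₁ V₂ W : Type*} [AddCommGroup V₁] [Module ℝ V₁] [AddCommGroup V₂] [Module ℝ V₂]
  [AddCommGroup W] [Module ℝ W]
  {Q₁ : QuadraticForm ℝ V₁} {Q₂ : QuadraticForm ℝ V₂} {Q : QuadraticForm ℝ W}

/-- The homomorphism `Spin(V₁) × Spin(V₂) → Spin(W)` given by orthogonal isometric maps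
`V₁ → W ← V₂`. -/
def spinProd (f₁ : Q₁ →qᵢ Q) (f₂ : Q₂ →qᵢ Q) (hf : ∀ x y, Q.IsOrtho (f₁ x) (f₂ y)) :
    spinGroup Q₁ × spinGroup Q₂ →* spinGroup Q :=
  (spinMap f₁).noncommCoprod (spinMap f₂) fun x y => Subtype.ext
    (CliffordAlgebra.commute_map_mul_map_of_isOrtho_of_mem_evenOdd_zero_left f₁ f₂ hf x y
      x.2.2 y.2.2)

end SpinProd

theorem coordIsometry_isOrtho {m₁ m₂ n : ℕ} {w₁ : Fin m₁ → ℝ} {w₂ : Fin m₂ → ℝ} {w : Fin n → ℝ}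
    (e₁ : Fin m₁ ↪ Fin n) (e₂ : Fin m₂ ↪ Fin n) (h₁ : ∀ i, w (e₁ i) = w₁ i)
    (h₂ : ∀ i, w (e₂ i) = w₂ i) (hd : ∀ i j, e₁ i ≠ e₂ j) (x : Fin m₁ → ℝ) (y : Fin m₂ → ℝ) :
    (QuadraticMap.weightedSumSquares ℝ w).IsOrtho
      (coordIsometry w₁ w e₁ h₁ x) (coordIsometry w₂ w e₂ h₂ y) := by
  change QuadraticMap.weightedSumSquares ℝ w (Function.ExtendByZero.linearMap ℝ e₁ x +
      Function.ExtendByZero.linearMap ℝ e₂ y) =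
    QuadraticMap.weightedSumSquares ℝ w (Function.ExtendByZero.linearMap ℝ e₁ x) +
    QuadraticMap.weightedSumSquares ℝ w (Function.ExtendByZero.linearMap ℝ e₂ y)
  simp only [QuadraticMap.weightedSumSquares_apply, ← Finset.sum_add_distrib]
  refine Finset.sum_congr rfl fun j _ => ?_
  by_cases hj : ∃ i, e₁ i = j
  · obtain ⟨i, rfl⟩ := hj
    have : ¬ ∃ k, e₂ k = e₁ i := fun ⟨k, hk⟩ => hd i k hk.symm
    simp [Function.extend_apply' _ _ _ this]
  · simp [Function.extend_apply' _ _ _ hj]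

/-- The vector part of an element of a real Clifford algebra. -/
def cliffordVecPart {V : Type*} [AddCommGroup V] [Module ℝ V] (Q : QuadraticForm ℝ V) :
    CliffordAlgebra Q →ₗ[ℝ] V :=
  ExteriorAlgebra.ιInv ∘ₗ (CliffordAlgebra.equivExterior Q).toLinearMap

theorem cliffordVecPart_ι {V : Type*} [AddCommGroup V] [Module ℝ V] (Q : QuadraticForm ℝ V)
    (v : V) : cliffordVecPart Q (CliffordAlgebra.ι Q v) = v := by
  simp only [cliffordVecPart, LinearMap.comp_apply, LinearEquiv.coe_coe]
  rw [show CliffordAlgebra.equivExterior Q (CliffordAlgebra.ι Q v) = ExteriorAlgebra.ι ℝ v from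
    CliffordAlgebra.changeForm_ι CliffordAlgebra.changeForm.associated_neg_proof v]
  exact ExteriorAlgebra.ι_leftInverse v

theorem ι_cliffordVecPart_conj {V : Type*} [AddCommGroup V] [Module ℝ V] {Q : QuadraticForm ℝ V}
    (g : spinGroup Q) (v : V) :
    CliffordAlgebra.ι Q (cliffordVecPart Q (g * CliffordAlgebra.ι Q v * star (g : CliffordAlgebra Q)))
      = g * CliffordAlgebra.ι Q v * star (g : CliffordAlgebra Q) := by
  obtain ⟨w, hw⟩ := spinGroup.conjAct_smul_ι_mem_range_ι (x := spinGroup.toUnits g) g.2 v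
  rw [ConjAct.units_smul_def] at hw
  replace hw : CliffordAlgebra.ι Q w
    = g * CliffordAlgebra.ι Q v * star (g : CliffordAlgebra Q) := hw
  rw [← hw, cliffordVecPart_ι]

/-- The vector representation of `Spin(V)`: `v ↦ g v g⁻¹` in the Clifford algebra. -/
def vectorRep {V : Type*} [AddCommGroup V] [Module ℝ V] (Q : QuadraticForm ℝ V) :
    Representation ℝ (spinGroup Q) V where
  toFun g := cliffordVecPart Q ∘ₗ LinearMap.mulRight ℝ (star (g : CliffordAlgebra Q)) ∘ₗ
    LinearMap.mulLeft ℝ (g : CliffordAlgebra Q) ∘ₗ CliffordAlgebra.ι Q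
  map_one' := by ext v; simp [cliffordVecPart_ι]
  map_mul' g h := by
    ext v
    simp only [LinearMap.comp_apply, LinearMap.mulLeft_apply, LinearMap.mulRight_apply,
      Module.End.mul_apply, ι_cliffordVecPart_conj]
    simp [mul_assoc]

/-- The `k`-th exterior power of a representation. -/
def wedgeRep {G V : Type*} [Monoid G] [AddCommGroup V] [Module ℝ V] (k : ℕ)
    (ρ : Representation ℝ G V) : Representation ℝ G (⋀[ℝ]^k V) where
  toFun g := exteriorPower.map k (ρ g)
  map_one' := by rw [map_one]; exact exteriorPower.map_id
  map_mul' g h := by rw [map_mul]; exact exteriorPower.map_comp (ρ h) (ρ g)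

/-- The subspace fixed by the first factor in a representation of `L × H`. -/
def fixedSpace {L H V : Type*} [Group L] [Group H] [AddCommGroup V] [Module ℝ V]
    (ρ : Representation ℝ (L × H) V) : Submodule ℝ V :=
  Representation.invariants (ρ.comp (MonoidHom.inl L H))

/-- The fixed-point functor: the vectors fixed by `L` in a representation of `L × H`,
as a representation of `H`. -/
def fixedRep {L H V : Type*} [Group L] [Group H] [AddCommGroup V] [Module ℝ V]
    (ρ : Representation ℝ (L × H) V) :
    Representation ℝ H (fixedSpace ρ) :=
  Representation.subrepresentation (ρ.comp (MonoidHom.inr L H)) _ fun h v hv l => by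
    have h1 : ρ ((l, 1) * (1, h)) v = ρ ((1, h) * (l, 1)) v := by simp
    rw [map_mul, map_mul, Module.End.mul_apply, Module.End.mul_apply] at h1
    exact h1.trans (congrArg _ (hv l))

/-- The outer tensor product of complex representations. -/
def outerTensor {G H V W : Type*} [Group G] [Group H] [AddCommGroup V] [Module ℂ V]
    [AddCommGroup W] [Module ℂ W] (ρ : Representation ℂ G V) (σ : Representation ℂ H W) :
    Representation ℂ (G × H) (TensorProduct ℂ V W) :=
  Representation.tprod (ρ.comp (MonoidHom.fst G H)) (σ.comp (MonoidHom.snd G H))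

/-- The real representation underlying a complex representation. -/
def realify {G V : Type*} [Group G] [AddCommGroup V] [Module ℂ V] [Module ℝ V]
    [IsScalarTower ℝ ℂ V] (ρ : Representation ℂ G V) : Representation ℝ G V where
  toFun g := (ρ g).restrictScalars ℝ
  map_one' := by ext; simp
  map_mul' g h := by ext; simp


/-! ### SU(2), U(1) -/

theorem ι_mul_ι_mem_spinGroup {V : Type*} [AddCommGroup V] [Module ℝ V] (Q : QuadraticForm ℝ V)
    (u v : V) (hu : Q u = 1) (hv : Q v = 1) :
    CliffordAlgebra.ι Q u * CliffordAlgebra.ι Q v ∈ spinGroup Q := by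
  have hu' : CliffordAlgebra.ι Q u * CliffordAlgebra.ι Q u = 1 := by
    rw [CliffordAlgebra.ι_sq_scalar, hu, map_one]
  have hv' : CliffordAlgebra.ι Q v * CliffordAlgebra.ι Q v = 1 := by
    rw [CliffordAlgebra.ι_sq_scalar, hv, map_one]
  refine ⟨⟨⟨⟨_, _, hu', hu'⟩ * ⟨_, _, hv', hv'⟩, ?_, rfl⟩, ?_⟩, ?_⟩
  · exact mul_mem (Subgroup.subset_closure ⟨u, rfl⟩) (Subgroup.subset_closure ⟨v, rfl⟩)
  · change _ ∈ unitary _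
    rw [Unitary.mem_iff]
    simp only [CliffordAlgebra.star_def, map_mul, CliffordAlgebra.involute_ι,
      CliffordAlgebra.reverse.map_mul, CliffordAlgebra.reverse_ι, neg_mul_neg]
    constructor
    · rw [mul_assoc, ← mul_assoc (CliffordAlgebra.ι Q u), hu', one_mul, hv']
    · rw [mul_assoc, ← mul_assoc (CliffordAlgebra.ι Q v), hv', one_mul, hu']
  · exact CliffordAlgebra.ι_mul_ι_mem_evenOdd_zero Q u v

/-- The generator `Γ_i` of the Clifford algebra of a diagonal form. -/
def cliffordGen {n : ℕ} (w : Fin n → ℝ) (i : Fin n) :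
    CliffordAlgebra (QuadraticMap.weightedSumSquares ℝ w) :=
  CliffordAlgebra.ι _ (Pi.single i 1)

theorem cliffordGen_sq {n : ℕ} (w : Fin n → ℝ) (i : Fin n) :
    cliffordGen w i * cliffordGen w i = algebraMap ℝ _ (w i) := by
  rw [cliffordGen, CliffordAlgebra.ι_sq_scalar, QuadraticMap.weightedSumSquares_apply]
  congr 1
  rw [Finset.sum_eq_single i] <;> simp +contextual

theorem cliffordGen_anticomm {n : ℕ} (w : Fin n → ℝ) {i j : Fin n} (h : i ≠ j) :
    cliffordGen w i * cliffordGen w j = -(cliffordGen w j * cliffordGen w i) := by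
  refine CliffordAlgebra.ι_mul_ι_comm_of_isOrtho ?_
  change QuadraticMap.weightedSumSquares ℝ w (_ + _) = QuadraticMap.weightedSumSquares ℝ w _ +
    QuadraticMap.weightedSumSquares ℝ w _
  simp only [QuadraticMap.weightedSumSquares_apply, ← Finset.sum_add_distrib]
  refine Finset.sum_congr rfl fun k _ => ?_
  by_cases h1 : k = i
  · subst h1; simp [h]
  · simp [Pi.single_apply, h1]

theorem rotation_mem_spinGroup {n : ℕ} (w : Fin n → ℝ) {i j : Fin n} (h : i ≠ j)
    (hi : w i = 1) (hj : w j = 1) {c s : ℝ} (hcs : c ^ 2 + s ^ 2 = 1) :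
    algebraMap ℝ _ c + s • (cliffordGen w i * cliffordGen w j) ∈
      spinGroup (QuadraticMap.weightedSumSquares ℝ w) := by
  have h1 : algebraMap ℝ _ c + s • (cliffordGen w i * cliffordGen w j) =
      CliffordAlgebra.ι (QuadraticMap.weightedSumSquares ℝ w) (Pi.single i 1) *
      CliffordAlgebra.ι _ (Pi.single i c + Pi.single j s) := by
    have e1 : (Pi.single i c + Pi.single j s : Fin n → ℝ) =
        c • Pi.single i 1 + s • Pi.single j 1 := by
      simp [← Pi.single_smul]
    rw [e1, map_add, map_smul, map_smul, mul_add, mul_smul_comm, mul_smul_comm]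
    change _ = c • (cliffordGen w i * cliffordGen w i) + s • (cliffordGen w i * cliffordGen w j)
    rw [cliffordGen_sq, hi, map_one, Algebra.algebraMap_eq_smul_one]
  rw [h1]
  refine ι_mul_ι_mem_spinGroup _ _ _ ?_ ?_
  · rw [QuadraticMap.weightedSumSquares_apply, Finset.sum_eq_single i]
    · simp [hi]
    · simp +contextual
    · simp
  · rw [QuadraticMap.weightedSumSquares_apply, ← hcs, Finset.sum_eq_add i j h]
    · simp [hi, hj, h, h.symm]; ring
    · intro k _ hk; simp [hk.1, hk.2]
    · simp
    · simp

/-- The coordinate signs of Minkowski space `ℝ^{n-1,1}`: `diag(-1,1,…,1)`. -/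
def minkSign (n : ℕ) (i : Fin n) : ℝ := if i.val = 0 then -1 else 1

/-- The coordinate signs of Euclidean space `ℝⁿ`. -/
def euclSign (n : ℕ) (_ : Fin n) : ℝ := 1

/-- `Spin(n-1,1)`. -/
abbrev SpinMink (n : ℕ) := spinGroup (QuadraticMap.weightedSumSquares ℝ (minkSign n))

/-- `Spin(n)`. -/
abbrev SpinEucl (n : ℕ) := spinGroup (QuadraticMap.weightedSumSquares ℝ (euclSign n))

/-- `U(1) ≅ Spin(2)`, `e^{iθ} ↦ exp(θ Γ₀Γ₁) = cos θ + sin θ Γ₀Γ₁`. -/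
def circleToSpin2 : Circle →* SpinEucl 2 where
  toFun z := ⟨algebraMap ℝ _ (z : ℂ).re +
      (z : ℂ).im • (cliffordGen (euclSign 2) 0 * cliffordGen (euclSign 2) 1),
    rotation_mem_spinGroup _ (by decide) rfl rfl (by
      have := Circle.normSq_coe z
      rw [Complex.normSq_apply] at this
      linarith)⟩
  map_one' := Subtype.ext (by simp)
  map_mul' z z' := Subtype.ext (by
    have h : (cliffordGen (euclSign 2) 0 * cliffordGen (euclSign 2) 1) *
        (cliffordGen (euclSign 2) 0 * cliffordGen (euclSign 2) 1) = -1 := by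
      rw [mul_assoc, ← mul_assoc (cliffordGen (euclSign 2) 1),
        cliffordGen_anticomm (euclSign 2) (show (1 : Fin 2) ≠ 0 by decide), neg_mul, mul_neg,
        mul_assoc, cliffordGen_sq, ← mul_assoc, cliffordGen_sq]
      simp [euclSign]
    simp only [Circle.coe_mul, Complex.mul_re, Complex.mul_im, Submonoid.coe_mul,
      Algebra.algebraMap_eq_smul_one, add_mul, mul_add, smul_mul_assoc, mul_smul_comm, one_mul,
      mul_one, h]
    module)

/-- The quaternion `r + x i + y j + z k`. -/
def quat (r x y z : ℝ) : Quaternion ℝ := ⟨r, x, y, z⟩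

@[simp] theorem quat_re (r x y z : ℝ) : (quat r x y z).re = r := rfl
@[simp] theorem quat_imI (r x y z : ℝ) : (quat r x y z).imI = x := rfl
@[simp] theorem quat_imJ (r x y z : ℝ) : (quat r x y z).imJ = y := rfl
@[simp] theorem quat_imK (r x y z : ℝ) : (quat r x y z).imK = z := rfl

section SU2

variable {A : Type*} [Ring A] [Algebra ℝ A]

/-- For anticommuting `a, b, c, d` of square `1`, the unit quaternion `q` acting as the quaternion
units `-½(ab + cd)`, `-½(ac + db)`, `-½(ad + bc)` on the `-1`-eigenspace of `abcd`, and as `1` on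
the `+1`-eigenspace. -/
def quatInClifford (a b c d : A) (q : Quaternion ℝ) : A :=
  (1 / 2 : ℝ) • (1 + a * b * c * d) + q.re • ((1 / 2 : ℝ) • (1 - a * b * c * d)) +
    (-q.imI / 2) • (a * b + c * d) + (-q.imJ / 2) • (a * c + d * b) +
    (-q.imK / 2) • (a * d + b * c)

theorem quatInClifford_one (a b c d : A) : quatInClifford a b c d 1 = 1 := by
  simp only [quatInClifford, Quaternion.re_one, Quaternion.imI_one, Quaternion.imJ_one,
    Quaternion.imK_one]
  module

theorem quatInClifford_mul {a b c d : A} (ha : a * a = 1) (hb : b * b = 1) (hc : c * c = 1)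
    (hd : d * d = 1) (hab : b * a = -(a * b)) (hac : c * a = -(a * c)) (had : d * a = -(a * d))
    (hbc : c * b = -(b * c)) (hbd : d * b = -(b * d)) (hcd : d * c = -(c * d))
    (p q : Quaternion ℝ) :
    quatInClifford a b c d (p * q) = quatInClifford a b c d p * quatInClifford a b c d q := by
  have ha' (x : A) : a * (a * x) = x := by rw [← mul_assoc, ha, one_mul]
  have hb' (x : A) : b * (b * x) = x := by rw [← mul_assoc, hb, one_mul]
  have hc' (x : A) : c * (c * x) = x := by rw [← mul_assoc, hc, one_mul]
  have hab' (x : A) : b * (a * x) = -(a * (b * x)) := by rw [← mul_assoc, hab, neg_mul, mul_assoc]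
  have hac' (x : A) : c * (a * x) = -(a * (c * x)) := by rw [← mul_assoc, hac, neg_mul, mul_assoc]
  have had' (x : A) : d * (a * x) = -(a * (d * x)) := by rw [← mul_assoc, had, neg_mul, mul_assoc]
  have hbc' (x : A) : c * (b * x) = -(b * (c * x)) := by rw [← mul_assoc, hbc, neg_mul, mul_assoc]
  have hbd' (x : A) : d * (b * x) = -(b * (d * x)) := by rw [← mul_assoc, hbd, neg_mul, mul_assoc]
  have hcd' (x : A) : d * (c * x) = -(c * (d * x)) := by rw [← mul_assoc, hcd, neg_mul, mul_assoc]
  simp only [quatInClifford, Quaternion.re_mul, Quaternion.imI_mul, Quaternion.imJ_mul,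
    Quaternion.imK_mul, mul_add, add_mul, mul_sub, sub_mul, smul_mul_assoc, mul_smul_comm,
    smul_add, smul_sub, one_mul, mul_one, mul_assoc, mul_neg, neg_mul, smul_neg, neg_neg,
    ha, hb, hc, hd, ha', hb', hc', hab, hac, hbc, hbd, hcd, hab', hac', had', hbc', hbd',
    hcd']
  module


theorem quatInClifford_commute {a b c d : A} (ha : a * a = 1) (hb : b * b = 1) (hc : c * c = 1)
    (hd : d * d = 1) (hab : b * a = -(a * b)) (hac : c * a = -(a * c)) (had : d * a = -(a * d))
    (hbc : c * b = -(b * c)) (hbd : d * b = -(b * d)) (hcd : d * c = -(c * d))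
    (p q : Quaternion ℝ) :
    quatInClifford a b c d p * quatInClifford (-a) b c d q =
      quatInClifford (-a) b c d q * quatInClifford a b c d p := by
  have ha' (x : A) : a * (a * x) = x := by rw [← mul_assoc, ha, one_mul]
  have hb' (x : A) : b * (b * x) = x := by rw [← mul_assoc, hb, one_mul]
  have hc' (x : A) : c * (c * x) = x := by rw [← mul_assoc, hc, one_mul]
  have hab' (x : A) : b * (a * x) = -(a * (b * x)) := by rw [← mul_assoc, hab, neg_mul, mul_assoc]
  have hac' (x : A) : c * (a * x) = -(a * (c * x)) := by rw [← mul_assoc, hac, neg_mul, mul_assoc]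
  have had' (x : A) : d * (a * x) = -(a * (d * x)) := by rw [← mul_assoc, had, neg_mul, mul_assoc]
  have hbc' (x : A) : c * (b * x) = -(b * (c * x)) := by rw [← mul_assoc, hbc, neg_mul, mul_assoc]
  have hbd' (x : A) : d * (b * x) = -(b * (d * x)) := by rw [← mul_assoc, hbd, neg_mul, mul_assoc]
  have hcd' (x : A) : d * (c * x) = -(c * (d * x)) := by rw [← mul_assoc, hcd, neg_mul, mul_assoc]
  simp only [quatInClifford, mul_add, add_mul, mul_sub, sub_mul, smul_mul_assoc, mul_smul_comm,
    smul_add, smul_sub, one_mul, mul_one, mul_assoc, mul_neg, neg_mul, smul_neg, neg_neg,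
    ha, hb, hc, hd, ha', hb', hc', hab, hac, hbc, hbd, hcd, hab', hac', had', hbc', hbd',
    hcd']
  module

theorem quatInClifford_expI (a b c d : A) (t : ℝ) :
    quatInClifford a b c d (quat (Real.cos (2 * t)) (Real.sin (2 * t)) 0 0) =
      (algebraMap ℝ A (Real.cos t) + (-Real.sin t) • (a * b)) *
      (algebraMap ℝ A (Real.cos t) + (-Real.sin t) • (c * d)) := by
  simp only [quatInClifford, quat_re, quat_imI, quat_imJ, quat_imK, Algebra.algebraMap_eq_smul_one, mul_add, add_mul, smul_mul_assoc,
    mul_smul_comm, one_mul, mul_one, Real.cos_two_mul, Real.sin_two_mul, smul_smul, ← mul_assoc]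
  match_scalars <;> nlinarith [Real.sin_sq_add_cos_sq t]

theorem quatInClifford_expJ {a b c d : A} (h : c * (d * b) = b * c * d) (t : ℝ) :
    quatInClifford a b c d (quat (Real.cos (2 * t)) 0 (Real.sin (2 * t)) 0) =
      (algebraMap ℝ A (Real.cos t) + (-Real.sin t) • (a * c)) *
      (algebraMap ℝ A (Real.cos t) + (-Real.sin t) • (d * b)) := by
  have h' : a * c * d * b = a * b * c * d := by simp only [mul_assoc] at h ⊢; rw [h]
  simp only [quatInClifford, quat_re, quat_imI, quat_imJ, quat_imK, Algebra.algebraMap_eq_smul_one, mul_add, add_mul, smul_mul_assoc,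
    mul_smul_comm, one_mul, mul_one, Real.cos_two_mul, Real.sin_two_mul, smul_smul, ← mul_assoc, h']
  match_scalars <;> nlinarith [Real.sin_sq_add_cos_sq t]

theorem exists_polar (x y : ℝ) : ∃ r t : ℝ, x = r * Real.cos t ∧ y = r * Real.sin t ∧
    r ^ 2 = x ^ 2 + y ^ 2 := by
  refine ⟨‖(⟨x, y⟩ : ℂ)‖, Complex.arg ⟨x, y⟩, ?_, ?_, ?_⟩
  · rw [Complex.norm_mul_cos_arg]
  · rw [Complex.norm_mul_sin_arg]
  · rw [← Complex.normSq_eq_norm_sq, Complex.normSq_apply]; ring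

theorem exists_hopf (q : Quaternion ℝ) (hq : Quaternion.normSq q = 1) : ∃ s t u : ℝ,
    q = quat (Real.cos (2 * s)) (Real.sin (2 * s)) 0 0 * quat (Real.cos (2 * t)) 0 (Real.sin (2 * t)) 0 *
      quat (Real.cos (2 * u)) (Real.sin (2 * u)) 0 0 := by
  obtain ⟨r, α, h1, h2, h3⟩ := exists_polar q.re q.imI
  obtain ⟨r', β, h1', h2', h3'⟩ := exists_polar q.imJ q.imK
  obtain ⟨r'', t, h1'', h2'', h3''⟩ := exists_polar r r'
  rw [Quaternion.normSq_def'] at hq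
  have hr : r'' ^ 2 = 1 := by rw [h3'', h3, h3']; linarith
  have key : ∀ t : ℝ, r = Real.cos t → r' = Real.sin t → ∃ s t u : ℝ,
    q = quat (Real.cos (2 * s)) (Real.sin (2 * s)) 0 0 * quat (Real.cos (2 * t)) 0 (Real.sin (2 * t)) 0 *
      quat (Real.cos (2 * u)) (Real.sin (2 * u)) 0 0 := by
    rintro t rfl rfl
    refine ⟨(α + β) / 4, t / 2, (α - β) / 4, ?_⟩
    have e1 : α = 2 * ((α + β) / 4) + 2 * ((α - β) / 4) := by ring
    have e2 : β = 2 * ((α + β) / 4) - 2 * ((α - β) / 4) := by ring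
    have e3 : 2 * (t / 2) = t := by ring
    rw [e3]
    rw [e1] at h1 h2
    rw [e2] at h1' h2'
    rw [Real.cos_add] at h1
    rw [Real.sin_add] at h2
    rw [Real.cos_sub] at h1'
    rw [Real.sin_sub] at h2'
    ext
    · rw [h1]; simp; ring
    · rw [h2]; simp; ring
    · rw [h1']; simp; ring
    · rw [h2']; simp; ring
  rcases mul_self_eq_one_iff.mp (by rw [← sq]; exact hr : r'' * r'' = 1) with h | h
  · exact key t (by rw [h1'', h, one_mul]) (by rw [h2'', h, one_mul])
  · exact key (t + Real.pi) (by rw [h1'', h, Real.cos_add_pi]; ring)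
      (by rw [h2'', h, Real.sin_add_pi]; ring)

end SU2

/-- The group `SU(2)`. -/
abbrev SU2 := Matrix.specialUnitaryGroup (Fin 2) ℂ

theorem su2_entries (g : SU2) : g.1 1 0 = -star (g.1 0 1) ∧ g.1 1 1 = star (g.1 0 0) ∧
    Complex.normSq (g.1 0 0) + Complex.normSq (g.1 0 1) = 1 := by
  obtain ⟨hu, hd⟩ := Matrix.mem_specialUnitaryGroup_iff.mp g.2
  have h1 : star g.1 = Matrix.adjugate g.1 := by
    have e1 : Matrix.adjugate g.1 * g.1 = 1 := by rw [Matrix.adjugate_mul, hd, one_smul]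
    have e2 : g.1 * star g.1 = 1 := (Unitary.mem_iff.mp hu).2
    calc star g.1 = (Matrix.adjugate g.1 * g.1) * star g.1 := by rw [e1, one_mul]
      _ = _ := by rw [mul_assoc, e2, mul_one]
  rw [Matrix.adjugate_fin_two] at h1
  have h00 := congrFun (congrFun h1 0) 0
  have h10 := congrFun (congrFun h1 1) 0
  simp only [Matrix.star_apply, Matrix.of_apply, Matrix.cons_val] at h00 h10
  have a1 : g.1 1 0 = -star (g.1 0 1) := by rw [h10, neg_neg]
  refine ⟨a1, h00.symm, ?_⟩
  rw [Matrix.det_fin_two, ← h00, a1] at hd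
  have := congrArg Complex.re hd
  simp [Complex.normSq_apply] at this ⊢
  linarith

/-- The identification of `SU(2)` with the unit quaternions,
`[[z, w], [-w̄, z̄]] ↦ z + w j`. -/
def su2Quat : SU2 →* Quaternion ℝ where
  toFun g := quat (g.1 0 0).re (g.1 0 0).im (g.1 0 1).re (g.1 0 1).im
  map_one' := by apply Quaternion.ext <;> simp <;> rfl
  map_mul' g h := by
    obtain ⟨a1, a2, -⟩ := su2_entries h
    ext <;> simp [Matrix.mul_apply, Fin.sum_univ_two, a1, a2] <;> ring

theorem normSq_su2Quat (g : SU2) : Quaternion.normSq (su2Quat g) = 1 := by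
  obtain ⟨-, -, h⟩ := su2_entries g
  rw [Quaternion.normSq_def']
  simp only [Complex.normSq_apply] at h
  simp only [su2Quat, MonoidHom.coe_mk, OneHom.coe_mk, quat_re, quat_imI, quat_imJ, quat_imK]
  linarith

/-- The generators of the Clifford algebra of Euclidean `ℝ⁴`. -/
abbrev gen4 (i : Fin 4) : CliffordAlgebra (QuadraticMap.weightedSumSquares ℝ (euclSign 4)) :=
  cliffordGen (euclSign 4) i

theorem gen4_sq (i : Fin 4) : gen4 i * gen4 i = 1 := by
  rw [cliffordGen_sq]; simp [euclSign]

theorem gen4_mem {i j : Fin 4} (h : i ≠ j) (c s : ℝ) (hcs : c ^ 2 + s ^ 2 = 1) :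
    algebraMap ℝ _ c + s • (gen4 i * gen4 j) ∈ SpinEucl 4 :=
  rotation_mem_spinGroup _ h rfl rfl hcs

theorem gen4_comm {i j k : Fin 4} (h : i ≠ j) (h' : i ≠ k) :
    gen4 i * (gen4 j * gen4 k) = gen4 j * gen4 k * gen4 i := by
  rw [← mul_assoc, cliffordGen_anticomm _ h, neg_mul, mul_assoc, cliffordGen_anticomm _ h']
  simp [mul_assoc]

theorem quat4_mul {ε : ℝ} (hε : ε ^ 2 = 1) (p q : Quaternion ℝ) :
    quatInClifford (ε • gen4 0) (gen4 1) (gen4 2) (gen4 3) (p * q) =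
      quatInClifford (ε • gen4 0) (gen4 1) (gen4 2) (gen4 3) p *
      quatInClifford (ε • gen4 0) (gen4 1) (gen4 2) (gen4 3) q := by
  have h (i j : Fin 4) (hij : i ≠ j) : gen4 i * gen4 j = -(gen4 j * gen4 i) :=
    cliffordGen_anticomm _ hij
  apply quatInClifford_mul
  · rw [smul_mul_smul_comm, gen4_sq, ← sq, hε, one_smul]
  all_goals first
    | exact gen4_sq _
    | exact h _ _ (by decide)
    | rw [smul_mul_assoc, mul_smul_comm, h _ 0 (by decide), smul_neg]

theorem quat4_mem {ε : ℝ} (hε : ε ^ 2 = 1) (q : Quaternion ℝ) (hq : Quaternion.normSq q = 1) :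
    quatInClifford (ε • gen4 0) (gen4 1) (gen4 2) (gen4 3) q ∈ SpinEucl 4 := by
  have hI (t : ℝ) : quatInClifford (ε • gen4 0) (gen4 1) (gen4 2) (gen4 3)
      (quat (Real.cos (2 * t)) (Real.sin (2 * t)) 0 0) ∈ SpinEucl 4 := by
    rw [quatInClifford_expI, smul_mul_assoc, smul_smul]
    refine mul_mem (gen4_mem (by decide) _ _ ?_) (gen4_mem (by decide) _ _ ?_)
    · rw [mul_pow, hε]; simp
    · simp
  have hJ (t : ℝ) : quatInClifford (ε • gen4 0) (gen4 1) (gen4 2) (gen4 3)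
      (quat (Real.cos (2 * t)) 0 (Real.sin (2 * t)) 0) ∈ SpinEucl 4 := by
    rw [quatInClifford_expJ, smul_mul_assoc, smul_smul]
    · refine mul_mem (gen4_mem (by decide) _ _ ?_) (gen4_mem (by decide) _ _ ?_)
      · rw [mul_pow, hε]; simp
      · simp
    · rw [gen4_comm (by decide) (by decide), mul_assoc, gen4_comm (by decide) (by decide)]
  obtain ⟨s, t, u, rfl⟩ := exists_hopf q hq
  rw [quat4_mul hε, quat4_mul hε]
  exact mul_mem (mul_mem (hI s) (hJ t)) (hI u)

/-- For `ε = 1` resp. `ε = -1`, the homomorphism `SU(2) → Spin(4)` that integrates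
`τ^i ↦ J_L^i` resp. `τ^i ↦ J_R^i`, where
`J_L¹ = -½R₁₂ - ½R₃₄`, `J_R¹ = ½R₁₂ - ½R₃₄` (and cyclically in `2, 3, 4`), `R_ab = ½Γ_aΓ_b`. -/
def su2ToSpin4 (ε : ℝ) (hε : ε ^ 2 = 1) : SU2 →* SpinEucl 4 where
  toFun g := ⟨quatInClifford (ε • gen4 0) (gen4 1) (gen4 2) (gen4 3) (su2Quat g),
    quat4_mem hε _ (normSq_su2Quat g)⟩
  map_one' := Subtype.ext ((congrArg (quatInClifford _ _ _ _) (map_one su2Quat)).trans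
    (quatInClifford_one _ _ _ _))
  map_mul' g h := Subtype.ext ((congrArg (quatInClifford _ _ _ _) (map_mul su2Quat g h)).trans
    (quat4_mul hε _ _))

/-- The exceptional isomorphism `SU(2)_L × SU(2)_R → Spin(4)`. -/
def su2xsu2ToSpin4 : SU2 × SU2 →* SpinEucl 4 :=
  (su2ToSpin4 1 (by norm_num)).noncommCoprod (su2ToSpin4 (-1) (by norm_num)) fun g h =>
    Subtype.ext (by
      have hc (i j : Fin 4) (hij : i ≠ j) : gen4 i * gen4 j = -(gen4 j * gen4 i) :=
        cliffordGen_anticomm _ hij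
      change quatInClifford ((1 : ℝ) • gen4 0) _ _ _ _ * quatInClifford ((-1 : ℝ) • gen4 0) _ _ _ _
        = quatInClifford ((-1 : ℝ) • gen4 0) _ _ _ _ * quatInClifford ((1 : ℝ) • gen4 0) _ _ _ _
      rw [one_smul, neg_one_smul]
      apply quatInClifford_commute <;> first | exact gen4_sq _ | exact hc _ _ (by decide))

/-- The one-parameter subgroup `θ ↦ exp(θ τ¹) = diag(e^{iθ/2}, e^{-iθ/2})` of `SU(2)`. -/
def su2Exp1 (θ : ℝ) : SU2 :=
  ⟨!![Complex.exp (θ / 2 * Complex.I), 0; 0, Complex.exp (-(θ / 2 * Complex.I))], by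
    rw [Matrix.mem_specialUnitaryGroup_iff]
    refine ⟨?_, by simp [Matrix.det_fin_two, ← Complex.exp_add]⟩
    rw [Matrix.mem_unitaryGroup_iff]
    ext i j
    fin_cases i <;> fin_cases j <;>
      simp [Matrix.mul_apply, Fin.sum_univ_two, Matrix.star_apply, ← Complex.exp_conj,
        ← Complex.exp_add, Complex.conj_ofReal, Complex.conj_ofNat]⟩

/-- The subgroup `ℤ₂^A = {1, exp(2π J_L¹)}` of `SU(2)_L`. -/
def Z2A : Subgroup SU2 := Subgroup.zpowers (su2Exp1 (2 * Real.pi))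

/-! ### Octonions and spinors -/

/-- The octonions `ℍ ⊕ ℍℓ`, with `(q, p)` standing for `q + pℓ`. -/
def Octonion : Type := Quaternion ℝ × Quaternion ℝ

namespace Octonion

instance : AddCommGroup Octonion := inferInstanceAs (AddCommGroup (Quaternion ℝ × Quaternion ℝ))
instance : Module ℝ Octonion := inferInstanceAs (Module ℝ (Quaternion ℝ × Quaternion ℝ))

/-- The octonion `q + pℓ`. -/
def mk (q p : Quaternion ℝ) : Octonion := (q, p)

/-- `(q₁ + p₁ℓ)(q₂ + p₂ℓ) = (q₁q₂ - p₂*p₁) + (p₂q₁ + p₁q₂*)ℓ`. -/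
instance : Mul Octonion where
  mul x y := mk (x.1 * y.1 - star y.2 * x.2) (y.2 * x.1 + x.2 * star y.1)

/-- `(q + pℓ)* = q* - pℓ`. -/
instance : Star Octonion where
  star x := mk (star x.1) (-x.2)

@[ext] theorem ext {x y : Octonion} (h1 : x.1 = y.1) (h2 : x.2 = y.2) : x = y := Prod.ext h1 h2

@[simp] theorem mk_fst (q p : Quaternion ℝ) : (mk q p).1 = q := rfl
@[simp] theorem mk_snd (q p : Quaternion ℝ) : (mk q p).2 = p := rfl
@[simp] theorem add_fst (x y : Octonion) : (x + y).1 = x.1 + y.1 := rfl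
@[simp] theorem add_snd (x y : Octonion) : (x + y).2 = x.2 + y.2 := rfl
@[simp] theorem neg_fst (x : Octonion) : (-x).1 = -x.1 := rfl
@[simp] theorem neg_snd (x : Octonion) : (-x).2 = -x.2 := rfl
@[simp] theorem zero_fst : (0 : Octonion).1 = 0 := rfl
@[simp] theorem zero_snd : (0 : Octonion).2 = 0 := rfl
@[simp] theorem smul_fst (r : ℝ) (x : Octonion) : (r • x).1 = r • x.1 := rfl
@[simp] theorem smul_snd (r : ℝ) (x : Octonion) : (r • x).2 = r • x.2 := rfl
@[simp] theorem mul_fst (x y : Octonion) : (x * y).1 = x.1 * y.1 - star y.2 * x.2 := rfl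
@[simp] theorem mul_snd (x y : Octonion) : (x * y).2 = y.2 * x.1 + x.2 * star y.1 := rfl
@[simp] theorem star_fst (x : Octonion) : (star x).1 = star x.1 := rfl
@[simp] theorem star_snd (x : Octonion) : (star x).2 = -x.2 := rfl

instance : NonUnitalNonAssocRing Octonion where
  left_distrib x y z := by
    apply ext <;> simp only [mul_fst, mul_snd, add_fst, add_snd, star_add] <;> noncomm_ring
  right_distrib x y z := by
    apply ext <;> simp only [mul_fst, mul_snd, add_fst, add_snd] <;> noncomm_ring
  zero_mul x := by apply ext <;> simp
  mul_zero x := by apply ext <;> simp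

instance : IsScalarTower ℝ Octonion Octonion where
  smul_assoc r x y := by
    change (r • x) * y = r • (x * y)
    apply ext <;> simp [smul_sub, smul_add]

instance : SMulCommClass ℝ Octonion Octonion where
  smul_comm r x y := by
    change r • (x * y) = x * (r • y)
    apply ext <;> simp [smul_sub, smul_add]

instance : StarAddMonoid Octonion where
  star_involutive x := by apply ext <;> simp
  star_add x y := by apply ext <;> simp [add_comm]

instance : StarModule ℝ Octonion where
  star_smul r x := by apply ext <;> simp

theorem mul_star_mul (x y : Octonion) :
    x * (star x * y) = (Quaternion.normSq x.1 + Quaternion.normSq x.2) • y := by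
  apply ext <;> apply Quaternion.ext <;> simp [Quaternion.normSq_def'] <;> ring

theorem star_mul_mul (x y : Octonion) :
    star x * (x * y) = (Quaternion.normSq x.1 + Quaternion.normSq x.2) • y := by
  apply ext <;> apply Quaternion.ext <;> simp [Quaternion.normSq_def'] <;> ring

end Octonion


section Chiral

variable {V A : Type*} [AddCommGroup V] [Module ℝ V] [Ring A] [Algebra ℝ A]

/-- For linear maps `σ, σ'` with `σ(v)σ'(v) = Q(v)` and `σ'(v)σ(v) = Q(v)`, the homomorphism from
`Spin(V)` that sends a product of vectors `u₁v₁⋯uₙvₙ` to `σ(u₁)σ'(v₁)⋯σ(uₙ)σ'(vₙ)`. -/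
def chiralHom (Q : QuadraticForm ℝ V) (σ σ' : V →ₗ[ℝ] A)
    (h : ∀ v, σ v * σ' v = algebraMap ℝ A (Q v)) (h' : ∀ v, σ' v * σ v = algebraMap ℝ A (Q v)) :
    spinGroup Q →* A where
  toFun g := CliffordAlgebra.even.lift Q (A := A)
    { bilin := (LinearMap.mul ℝ A).compl₁₂ σ σ'
      contract := h
      contract_mid := fun u v w => by
        change σ u * σ' v * (σ v * σ' w) = Q v • (σ u * σ' w)
        rw [mul_assoc, ← mul_assoc (σ' v), h', ← Algebra.smul_def, mul_smul_comm] }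
    ⟨g, g.2.2⟩
  map_one' := map_one _
  map_mul' g g' := map_mul (CliffordAlgebra.even.lift Q (A := A) _) (⟨(g : CliffordAlgebra Q), g.2.2⟩ : CliffordAlgebra.even Q)
    (⟨(g' : CliffordAlgebra Q), g'.2.2⟩ : CliffordAlgebra.even Q)

end Chiral

section Pauli

variable {K : Type*} [NonUnitalNonAssocRing K] [Module ℝ K] [IsScalarTower ℝ K K]
  [SMulCommClass ℝ K K] [StarAddMonoid K] [StarModule ℝ K]

/-- The left action on `K²` of the hermitian matrix `[[ε v₀ + v₁, x(v)], [x(v)*, ε v₀ - v₁]]`. -/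
def pauli {n : ℕ} (x : (Fin (n + 2) → ℝ) →ₗ[ℝ] K) (ε : ℝ) :
    (Fin (n + 2) → ℝ) →ₗ[ℝ] Module.End ℝ (K × K) :=
  LinearMap.mk₂ ℝ (fun v ψ => ((ε * v 0 + v 1) • ψ.1 + x v * ψ.2,
      star (x v) * ψ.1 + (ε * v 0 - v 1) • ψ.2))
    (fun u v ψ => by
      simp only [map_add, Pi.add_apply, star_add, add_mul, Prod.mk_add_mk]
      congr 1 <;> module)
    (fun c v ψ => by
      simp only [map_smul, Pi.smul_apply, star_smul, smul_mul_assoc, smul_eq_mul, Prod.smul_mk,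
        star_trivial]
      congr 1 <;> module)
    (fun v ψ φ => by
      simp only [Prod.fst_add, Prod.snd_add, mul_add, Prod.mk_add_mk]
      congr 1 <;> module)
    (fun c v ψ => by
      simp only [Prod.smul_fst, Prod.smul_snd, mul_smul_comm, Prod.smul_mk]
      congr 1 <;> module)

theorem pauli_mul_pauli {n : ℕ} (x : (Fin (n + 2) → ℝ) →ₗ[ℝ] K)
    (Q : QuadraticForm ℝ (Fin (n + 2) → ℝ))
    (h : ∀ v y, x v * (star (x v) * y) = (Q v + v 0 ^ 2 - v 1 ^ 2) • y)
    (h' : ∀ v y, star (x v) * (x v * y) = (Q v + v 0 ^ 2 - v 1 ^ 2) • y)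
    {ε ε' : ℝ} (hε : ε * ε' = -1) (hε' : ε + ε' = 0) (v : Fin (n + 2) → ℝ) :
    pauli x ε v * pauli x ε' v = algebraMap ℝ (Module.End ℝ (K × K)) (Q v) := by
  have e1 : ε' = -ε := by linarith
  have e2 : ε ^ 2 = 1 := by rw [e1] at hε; linarith
  subst e1
  refine LinearMap.ext fun ψ => ?_
  change (_, _) = (Q v • ψ.1, Q v • ψ.2)
  simp only [pauli, LinearMap.mk₂_apply, mul_add, h, h', mul_smul_comm]
  congr 1
  · match_scalars <;> first | ring1 | linear_combination (-(v 0) ^ 2) * e2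
  · match_scalars <;> first | ring1 | linear_combination (-(v 0) ^ 2) * e2

end Pauli

/-- The quaternion `v₂ + v₃ i + v₄ j + v₅ k` of a vector in `ℝ^{5,1}`. -/
def quatCoord : (Fin 6 → ℝ) →ₗ[ℝ] Quaternion ℝ where
  toFun v := quat (v 2) (v 3) (v 4) (v 5)
  map_add' u v := by ext <;> simp
  map_smul' c v := by ext <;> simp

/-- The octonion `(v₂ + v₃ i + v₄ j + v₅ k) + (v₆ + v₇ i + v₈ j + v₉ k)ℓ` of a vector in
`ℝ^{9,1}`. -/
def octCoord : (Fin 10 → ℝ) →ₗ[ℝ] Octonion where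
  toFun v := Octonion.mk (quat (v 2) (v 3) (v 4) (v 5)) (quat (v 6) (v 7) (v 8) (v 9))
  map_add' u v := by apply Octonion.ext <;> ext <;> simp
  map_smul' c v := by apply Octonion.ext <;> ext <;> simp

instance : StarModule ℝ (Quaternion ℝ) where
  star_smul r x := by ext <;> simp

theorem quatPauli_mul {ε ε' : ℝ} (hε : ε * ε' = -1) (hε' : ε + ε' = 0) (v : Fin 6 → ℝ) :
    pauli quatCoord ε v * pauli quatCoord ε' v =
      algebraMap ℝ _ (QuadraticMap.weightedSumSquares ℝ (minkSign 6) v) := by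
  have hQ (v : Fin 6 → ℝ) : QuadraticMap.weightedSumSquares ℝ (minkSign 6) v + v 0 ^ 2 - v 1 ^ 2 =
      Quaternion.normSq (quatCoord v) := by
    simp [QuadraticMap.weightedSumSquares_apply, Fin.sum_univ_succ, minkSign, Quaternion.normSq_def',
      quatCoord]
    ring
  refine pauli_mul_pauli _ _ (fun v y => ?_) (fun v y => ?_) hε hε' v
  · rw [hQ, ← mul_assoc, Quaternion.self_mul_star, Quaternion.coe_mul_eq_smul]
  · rw [hQ, ← mul_assoc, Quaternion.star_mul_self, Quaternion.coe_mul_eq_smul]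

theorem octPauli_mul {ε ε' : ℝ} (hε : ε * ε' = -1) (hε' : ε + ε' = 0) (v : Fin 10 → ℝ) :
    pauli octCoord ε v * pauli octCoord ε' v =
      algebraMap ℝ _ (QuadraticMap.weightedSumSquares ℝ (minkSign 10) v) := by
  have hQ (v : Fin 10 → ℝ) :
      QuadraticMap.weightedSumSquares ℝ (minkSign 10) v + v 0 ^ 2 - v 1 ^ 2 =
      Quaternion.normSq (octCoord v).1 + Quaternion.normSq (octCoord v).2 := by
    simp [QuadraticMap.weightedSumSquares_apply, Fin.sum_univ_succ, minkSign, Quaternion.normSq_def',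
      octCoord]
    ring
  refine pauli_mul_pauli _ _ (fun v y => ?_) (fun v y => ?_) hε hε' v
  · rw [hQ, Octonion.mul_star_mul]
  · rw [hQ, Octonion.star_mul_mul]

/-- The `8` of `Spin(5,1)` on `ℍ²`. -/
def rep8 : Representation ℝ (SpinMink 6) (Quaternion ℝ × Quaternion ℝ) :=
  chiralHom _ (pauli quatCoord (-1)) (pauli quatCoord 1)
    (quatPauli_mul (by norm_num) (by norm_num)) (quatPauli_mul (by norm_num) (by norm_num))

/-- The conjugate `8` of `Spin(5,1)` on `ℍ²`. -/
def rep8bar : Representation ℝ (SpinMink 6) (Quaternion ℝ × Quaternion ℝ) :=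
  chiralHom _ (pauli quatCoord 1) (pauli quatCoord (-1))
    (quatPauli_mul (by norm_num) (by norm_num)) (quatPauli_mul (by norm_num) (by norm_num))

/-- The `16` of `Spin(9,1)` on `𝕆²`. -/
def rep16 : Representation ℝ (SpinMink 10) (Octonion × Octonion) :=
  chiralHom _ (pauli octCoord (-1)) (pauli octCoord 1)
    (octPauli_mul (by norm_num) (by norm_num)) (octPauli_mul (by norm_num) (by norm_num))

/-- The conjugate `16` of `Spin(9,1)` on `𝕆²`. -/
def rep16bar : Representation ℝ (SpinMink 10) (Octonion × Octonion) :=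
  chiralHom _ (pauli octCoord 1) (pauli octCoord (-1))
    (octPauli_mul (by norm_num) (by norm_num)) (octPauli_mul (by norm_num) (by norm_num))

/-- The matrix `[[ε v₀ + v₁, v₂ + v₃ i], [v₂ - v₃ i, ε v₀ - v₁]]`. -/
def cpauli (ε : ℝ) : (Fin 4 → ℝ) →ₗ[ℝ] Matrix (Fin 2) (Fin 2) ℂ where
  toFun v := !![((ε * v 0 + v 1 : ℝ) : ℂ), ⟨v 2, v 3⟩; ⟨v 2, -v 3⟩, ((ε * v 0 - v 1 : ℝ) : ℂ)]
  map_add' u v := by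
    ext i j
    fin_cases i <;> fin_cases j <;> apply Complex.ext <;> simp <;> ring
  map_smul' c v := by
    ext i j
    fin_cases i <;> fin_cases j <;> apply Complex.ext <;> simp <;> ring

theorem cpauli_mul {ε ε' : ℝ} (hε : ε * ε' = -1) (hε' : ε + ε' = 0) (v : Fin 4 → ℝ) :
    cpauli ε v * cpauli ε' v =
      algebraMap ℝ _ (QuadraticMap.weightedSumSquares ℝ (minkSign 4) v) := by
  have e1 : ε' = -ε := by linarith
  have e2 : ε ^ 2 = 1 := by rw [e1] at hε; linarith
  subst e1
  have hQ : QuadraticMap.weightedSumSquares ℝ (minkSign 4) v =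
      -v 0 ^ 2 + v 1 ^ 2 + v 2 ^ 2 + v 3 ^ 2 := by
    simp [QuadraticMap.weightedSumSquares_apply, Fin.sum_univ_succ, minkSign]
    ring
  rw [hQ, Algebra.algebraMap_eq_smul_one]
  have hc (r : ℝ) : (r • (1 : Matrix (Fin 2) (Fin 2) ℂ)) = !![(r : ℂ), 0; 0, (r : ℂ)] := by
    ext i j
    fin_cases i <;> fin_cases j <;> simp
  rw [hc]
  ext i j
  fin_cases i <;> fin_cases j <;> apply Complex.ext <;>
    simp [cpauli, Matrix.mul_apply, Fin.sum_univ_two, -Complex.ofReal_add, -Complex.ofReal_sub,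
      -Complex.ofReal_neg, -Complex.ofReal_mul, -Complex.ofReal_pow] <;>
    first | ring1 | linear_combination (-(v 0) ^ 2) * e2

/-- The left Weyl representation `2_ℂ` of `Spin(3,1)`. -/
def weyl : Representation ℂ (SpinMink 4) (Fin 2 → ℂ) :=
  (Matrix.toLinAlgEquiv (R := ℂ) (Pi.basisFun ℂ (Fin 2)) : _ →* _).comp
    (chiralHom _ (cpauli (-1)) (cpauli 1)
      (cpauli_mul (by norm_num) (by norm_num)) (cpauli_mul (by norm_num) (by norm_num)))

/-- The right Weyl representation, the conjugate `2_ℂ` of `Spin(3,1)`. -/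
def weylBar : Representation ℂ (SpinMink 4) (Fin 2 → ℂ) :=
  (Matrix.toLinAlgEquiv (R := ℂ) (Pi.basisFun ℂ (Fin 2)) : _ →* _).comp
    (chiralHom _ (cpauli 1) (cpauli (-1))
      (cpauli_mul (by norm_num) (by norm_num)) (cpauli_mul (by norm_num) (by norm_num)))

/-- The Clifford action of `ℝ^{10,1}` on `𝕆² ⊕ 𝕆²`,
`Γ(v) = [[v₁₀, σ̄(v)], [σ(v), -v₁₀]]`. -/
def gamma11 : (Fin 11 → ℝ) →ₗ[ℝ]
    Module.End ℝ ((Octonion × Octonion) × (Octonion × Octonion)) :=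
  LinearMap.mk₂ ℝ (fun v ψ =>
      (v (Fin.last 10) • ψ.1 + pauli octCoord (-1) (fun i => v i.castSucc) ψ.2,
        pauli octCoord 1 (fun i => v i.castSucc) ψ.1 - v (Fin.last 10) • ψ.2))
    (fun u v ψ => by
      have h : (fun i : Fin 10 => (u + v) i.castSucc) =
        (fun i => u i.castSucc) + fun i => v i.castSucc := rfl
      simp only [h]
      simp only [map_add, LinearMap.add_apply, Pi.add_apply, Prod.mk_add_mk]
      congr 1 <;> module)
    (fun c v ψ => by
      have h : (fun i : Fin 10 => (c • v) i.castSucc) = c • (fun i => v i.castSucc) := rfl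
      simp only [h]
      simp only [map_smul, LinearMap.smul_apply, Pi.smul_apply, smul_eq_mul, Prod.smul_mk]
      congr 1 <;> module)
    (fun v ψ φ => by
      simp only [Prod.fst_add, Prod.snd_add, map_add, Prod.mk_add_mk]
      congr 1 <;> module)
    (fun c v ψ => by
      simp only [Prod.smul_fst, Prod.smul_snd, map_smul, Prod.smul_mk]
      congr 1 <;> module)

theorem gamma11_sq (v : Fin 11 → ℝ) : gamma11 v * gamma11 v =
    algebraMap ℝ _ (QuadraticMap.weightedSumSquares ℝ (minkSign 11) v) := by
  have hQ : QuadraticMap.weightedSumSquares ℝ (minkSign 11) v =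
      QuadraticMap.weightedSumSquares ℝ (minkSign 10) (fun i => v i.castSucc) +
        v (Fin.last 10) * v (Fin.last 10) := by
    rw [QuadraticMap.weightedSumSquares_apply, Fin.sum_univ_castSucc,
      QuadraticMap.weightedSumSquares_apply]
    congr 1
    simp [minkSign]
  have h1 (φ) := LinearMap.congr_fun (octPauli_mul (ε := -1) (ε' := 1) (by norm_num) (by norm_num)
    (fun i => v i.castSucc)) φ
  have h2 (φ) := LinearMap.congr_fun (octPauli_mul (ε := 1) (ε' := -1) (by norm_num) (by norm_num)
    (fun i => v i.castSucc)) φ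
  simp only [Module.End.mul_apply, Module.algebraMap_end_apply] at h1 h2
  rw [hQ]
  refine LinearMap.ext fun ψ => ?_
  change (_, _) = ((_ : ℝ) • ψ.1, (_ : ℝ) • ψ.2)
  simp only [gamma11, LinearMap.mk₂_apply, map_add, map_sub, map_smul, h1, h2]
  congr 1 <;> module

/-- The `32` of `Spin(10,1)` on `𝕆² ⊕ 𝕆²`. -/
def rep32 : Representation ℝ (SpinMink 11) ((Octonion × Octonion) × (Octonion × Octonion)) :=
  (CliffordAlgebra.lift _ ⟨gamma11, gamma11_sq⟩ : _ →* _).comp (spinGroup _).subtype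

/-! ### The group inclusions -/

/-- `Spin(5,1) × Spin(4) → Spin(9,1)`, for `ℝ^{5,1}` with coordinates `0,…,5` and `ℝ⁴` with
coordinates `6,…,9`. -/
def spin51x4 : SpinMink 6 × SpinEucl 4 →* SpinMink 10 :=
  spinProd (coordIsometry _ _ (Fin.castLEEmb (by norm_num)) fun _ => rfl)
    (coordIsometry _ _ (Fin.natAddEmb 6) fun i => if_neg (show 6 + i.val ≠ 0 by omega))
    (coordIsometry_isOrtho _ _ _ _ fun i j h => by
      have : i.val = 6 + j.val := congrArg Fin.val h
      omega)

/-- `Spin(3,1) × Spin(2) → Spin(5,1)`, for `ℝ^{3,1}` with coordinates `0,…,3` and `ℝ²` with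
coordinates `4, 5`. -/
def spin31x2 : SpinMink 4 × SpinEucl 2 →* SpinMink 6 :=
  spinProd (coordIsometry _ _ (Fin.castLEEmb (by norm_num)) fun _ => rfl)
    (coordIsometry _ _ (Fin.natAddEmb 4) fun i => if_neg (show 4 + i.val ≠ 0 by omega))
    (coordIsometry_isOrtho _ _ _ _ fun i j h => by
      have : i.val = 4 + j.val := congrArg Fin.val h
      omega)

/-- `Spin(9,1) → Spin(10,1)`. -/
def spin91to101 : SpinMink 10 →* SpinMink 11 :=
  spinMap (coordIsometry _ _ Fin.castSuccEmb fun _ => rfl)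

/-- `SU(2)_L × (Spin(5,1) × SU(2)_R) → Spin(9,1)`. -/
def fullHom : SU2 × (SpinMink 6 × SU2) →* SpinMink 10 where
  toFun x := spin51x4 (x.2.1, su2xsu2ToSpin4 (x.1, x.2.2))
  map_one' := by
    change spin51x4 (1, su2xsu2ToSpin4 1) = 1
    rw [map_one]; exact map_one _
  map_mul' x y := by
    change spin51x4 (_ * _, su2xsu2ToSpin4 ((x.1, x.2.2) * (y.1, y.2.2))) = _
    rw [map_mul]; exact map_mul spin51x4 (x.2.1, _) (y.2.1, _)

/-- `Spin(3,1) × (U(1)_V × SU(2)_R) → Spin(5,1) × SU(2)_R`. -/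
def residualHom : SpinMink 4 × (Circle × SU2) →* SpinMink 6 × SU2 where
  toFun x := (spin31x2 (x.1, circleToSpin2 x.2.1), x.2.2)
  map_one' := by
    change (spin31x2 (1, circleToSpin2 1), 1) = 1
    rw [map_one]; exact Prod.ext (map_one _) rfl
  map_mul' x y := by
    refine Prod.ext ?_ rfl
    change spin31x2 (_ * _, circleToSpin2 (x.2.1 * y.2.1)) = _
    rw [map_mul]; exact map_mul spin31x2 (x.1, _) (y.1, _)

/-- The restriction of a representation of `SU(2)_L × H` to `ℤ₂^A × H`. -/
def resZ2A {H V : Type*} [Group H] [AddCommGroup V] [Module ℝ V]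
    (ρ : Representation ℝ (SU2 × H) V) : Representation ℝ (Z2A × H) V :=
  ρ.comp (Z2A.subtype.prodMap (MonoidHom.id H))

/-! ### The representations of the residual groups -/

/-- The irrep of `U(1)` of charge `n` on `ℂ`. -/
def u1Rep (n : ℤ) : Representation ℂ Circle ℂ where
  toFun z := LinearMap.mulLeft ℂ ((z ^ n : Circle) : ℂ)
  map_one' := by ext; simp
  map_mul' z w := by ext; simp [mul_zpow]

/-- The fundamental representation `2_ℂ` of `SU(2)`. -/
def fund : Representation ℂ SU2 (Fin 2 → ℂ) :=
  (Matrix.toLinAlgEquiv (R := ℂ) (Pi.basisFun ℂ (Fin 2)) : _ →* _).comp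
    (Matrix.specialUnitaryGroup (Fin 2) ℂ).subtype

/-- The imaginary quaternions. -/
def imQuat : Submodule ℝ (Quaternion ℝ) where
  carrier := {q | q.re = 0}
  add_mem' {p q} hp hq := by
    change p.re + q.re = 0
    rw [hp, hq, add_zero]
  zero_mem' := rfl
  smul_mem' c q hq := by
    change c * q.re = 0
    rw [hq, mul_zero]

/-- The `3` of `SU(2)`: conjugation by unit quaternions on the imaginary quaternions. -/
def adj3 : Representation ℝ SU2 imQuat where
  toFun g := (LinearMap.mulRight ℝ (star (su2Quat g)) ∘ₗ LinearMap.mulLeft ℝ (su2Quat g)).restrict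
    (fun q hq => by
      replace hq : q.re = 0 := hq
      change (su2Quat g * q * star (su2Quat g)).re = 0
      simp [hq]
      ring)
  map_one' := LinearMap.ext fun q => Subtype.ext (by simp)
  map_mul' g h := LinearMap.ext fun q => Subtype.ext (by simp [mul_assoc])

/-- The vector representation `4` of `Spin(4)` as a representation of `SU(2)_L × SU(2)_R`; the
standard basis vectors are `e₆, e₇, e₈, e₉`. -/
def rep4 : Representation ℝ (SU2 × SU2) (Fin 4 → ℝ) :=
  (vectorRep _).comp su2xsu2ToSpin4

/-- The element `e_i ∧ e_j` of `∧²4`. -/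
def wedge2 (i j : Fin 4) : ⋀[ℝ]^2 (Fin 4 → ℝ) :=
  exteriorPower.ιMulti ℝ 2 ![Pi.single i 1, Pi.single j 1]

/-- The inclusion `ℍ² ⊂ 𝕆²`. -/
def quatToOct : (Quaternion ℝ × Quaternion ℝ) →ₗ[ℝ] Octonion × Octonion where
  toFun ψ := (Octonion.mk ψ.1 0, Octonion.mk ψ.2 0)
  map_add' ψ φ := by ext1 <;> apply Octonion.ext <;> simp
  map_smul' c ψ := by ext1 <;> apply Octonion.ext <;> simp

/-- The quaternion `z + w j`. -/
def compQuat (z w : ℂ) : Quaternion ℝ := quat z.re z.im w.re w.im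

end

/-! Every spinor representation in the statement sits inside one Clifford module, `diracTen`, on `𝕆²
⊕ 𝕆²`. Vectors of `ℝ^{9,1}` act there by off-diagonal blocks, so even elements are block diagonal.
The first block is the `16`, the second its conjugate, and both together are the restriction of the
`32`. `chiralHom_intertwine` reduces any comparison of an even Clifford action with a chiral
representation to products of two vectors. It is used for the `16`, the `8`, the Weyl representation
and their conjugates.

The decisive computation is the action of `Spin(4)`. A vector `u` in the coordinates 6 to 9 acts
through octonion multiplication by `uℓ`, and `(uℓ)(q + pℓ) = -p̄u + (uq̄)ℓ`. Hence a product of two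
such vectors has the form `q + pℓ ↦ q b̄ + (a p)ℓ`, which is `octTwist a b`. Inserting the
generators shows that `(g_L, g_R)` acts with `a = g_L` and `b = g_R` as unit quaternions
(`diracTen_su2xsu2`): the left group sees only the `ℍℓ` half, the right group only the `ℍ` half.

For spinors, the generator of `ℤ₂^A` is `a = -1`. Fixed vectors therefore have no `ℓ` component, and
then all of `SU(2)_L` fixes them. On the remaining `ℍ²`, `Spin(3,1)` acts by complex matrices from
the left, `exp(θ Γ₄Γ₅)` acts as left multiplication by `e^{-iθ}`, and `SU(2)_R` acts by right
multiplication by conjugates. Writing an element of `ℍ²` as `a₀ j - a₁` turns the last action into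
the fundamental representation on the index of `a`, which yields `2 ⊠ 1⁻ ⊠ 2` (`diracTen_residual`,
`branchingEquiv`).

For bosons, conjugating vectors by the same Clifford action gives `v ↦ g_L v ḡ_R` on `4 = ℍ`
(`quatVec_rep4`). The element `-1` of `SU(2)_L` is thus `-1` on `4` and on its odd exterior powers.
On two-forms, `v ∧ w ↦ v̄w - w̄v` cancels `g_L` and is conjugated by `g_R`. It is inverted on the
`SU(2)_L`-fixed forms by `imToWedge`, which is proved by averaging over `1, i, j, ji`. -/

noncomputable section

/-! ### Chiral spin representations inside Clifford modules -/

section Chiral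

variable {V A M N : Type*} [AddCommGroup V] [Module ℝ V] [Ring A] [Algebra ℝ A]
  [AddCommGroup M] [Module ℝ M] [AddCommGroup N] [Module ℝ N]

/-- A chiral representation is defined by lifting from the even subalgebra, which is generated by
products of two vectors. Agreement on such products therefore propagates to all even elements. The
map `φ` allows the chiral homomorphism to take values in matrices as well as in endomorphisms. -/
theorem chiralHom_intertwine {Q : QuadraticForm ℝ V} {σ σ' : V →ₗ[ℝ] A}
    (h : ∀ v, σ v * σ' v = algebraMap ℝ A (Q v)) (h' : ∀ v, σ' v * σ v = algebraMap ℝ A (Q v))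
    (F : CliffordAlgebra Q →ₐ[ℝ] Module.End ℝ N) (φ : A →ₐ[ℝ] Module.End ℝ M) (i : M →ₗ[ℝ] N)
    (hi : ∀ u v m, F (CliffordAlgebra.ι Q u) (F (CliffordAlgebra.ι Q v) (i m)) =
      i (φ (σ u * σ' v) m))
    (g : spinGroup Q) (m : M) :
    F g (i m) = i (φ (chiralHom Q σ σ' h h' g) m) := by
  let B : CliffordAlgebra.EvenHom Q A :=
    { bilin := (LinearMap.mul ℝ A).compl₁₂ σ σ'
      contract := h
      contract_mid := fun u v w => by
        change σ u * σ' v * (σ v * σ' w) = Q v • (σ u * σ' w)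
        rw [mul_assoc, ← mul_assoc (σ' v), h', ← Algebra.smul_def, mul_smul_comm] }
  -- The claim is made for all even elements, since the summands and factors met in the induction
  -- need not lie in the spin group.
  have key (x : CliffordAlgebra Q) (hx : x ∈ CliffordAlgebra.evenOdd Q 0) (m : M) :
      F x (i m) = i (φ (CliffordAlgebra.even.lift Q B ⟨x, hx⟩) m) := by
    induction x, hx using CliffordAlgebra.even_induction generalizing m with
    | algebraMap r =>
      have : CliffordAlgebra.even.lift Q B
          ⟨algebraMap ℝ _ r, SetLike.algebraMap_mem_graded _ _⟩ = algebraMap ℝ A r :=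
        AlgHom.commutes (CliffordAlgebra.even.lift Q B) r
      rw [this, AlgHom.commutes, AlgHom.commutes, Module.algebraMap_end_apply,
        Module.algebraMap_end_apply, map_smul]
    | add x y hx hy ihx ihy =>
      have : CliffordAlgebra.even.lift Q B ⟨x + y, Submodule.add_mem _ hx hy⟩ =
        CliffordAlgebra.even.lift Q B ⟨x, hx⟩ + CliffordAlgebra.even.lift Q B ⟨y, hy⟩ :=
        map_add (CliffordAlgebra.even.lift Q B) ⟨x, hx⟩ ⟨y, hy⟩
      rw [this, map_add, map_add, LinearMap.add_apply, LinearMap.add_apply, map_add, ihx, ihy]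
    | ι_mul_ι_mul u v x hx ih =>
      have hx' : CliffordAlgebra.ι Q u * CliffordAlgebra.ι Q v * x ∈ CliffordAlgebra.even Q :=
        mul_mem (CliffordAlgebra.ι_mul_ι_mem_evenOdd_zero Q u v) hx
      have h1 : CliffordAlgebra.even.lift Q B
            ⟨CliffordAlgebra.ι Q u * CliffordAlgebra.ι Q v * x, hx'⟩ =
          CliffordAlgebra.even.lift Q B ((CliffordAlgebra.even.ι Q).bilin u v) *
            CliffordAlgebra.even.lift Q B ⟨x, hx⟩ :=
        map_mul (CliffordAlgebra.even.lift Q B) ((CliffordAlgebra.even.ι Q).bilin u v) ⟨x, hx⟩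
      rw [h1, CliffordAlgebra.even.lift_ι, map_mul, map_mul, map_mul, Module.End.mul_apply,
        Module.End.mul_apply, Module.End.mul_apply, ih, hi]
      rfl
  exact key g g.2.2 m

end Chiral

/-- The action of the Clifford algebra of `ℝ^{9,1}` on `𝕆² ⊕ 𝕆²`. -/
def diracTen : CliffordAlgebra (QuadraticMap.weightedSumSquares ℝ (minkSign 10)) →ₐ[ℝ]
    Module.End ℝ ((Octonion × Octonion) × (Octonion × Octonion)) :=
  (CliffordAlgebra.lift _ ⟨gamma11, gamma11_sq⟩).comp
    (CliffordAlgebra.map (coordIsometry _ _ Fin.castSuccEmb fun _ => rfl))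

theorem coordIsometry_apply_image {m n : ℕ} {w : Fin m → ℝ} {w' : Fin n → ℝ} (e : Fin m ↪ Fin n)
    (h : ∀ i, w' (e i) = w i) (v : Fin m → ℝ) (i : Fin m) :
    coordIsometry w w' e h v (e i) = v i :=
  e.injective.extend_apply _ _ _

theorem coordIsometry_apply_of_ne {m n : ℕ} {w : Fin m → ℝ} {w' : Fin n → ℝ} (e : Fin m ↪ Fin n)
    (h : ∀ i, w' (e i) = w i) (v : Fin m → ℝ) {j : Fin n} (hj : ∀ i, e i ≠ j) :
    coordIsometry w w' e h v j = 0 :=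
  Function.extend_apply' _ _ _ fun ⟨i, hi⟩ => hj i hi

theorem diracTen_ι (v : Fin 10 → ℝ) (ψ : (Octonion × Octonion) × (Octonion × Octonion)) :
    diracTen (CliffordAlgebra.ι _ v) ψ = (pauli octCoord (-1) v ψ.2, pauli octCoord 1 v ψ.1) := by
  rw [diracTen, AlgHom.comp_apply, CliffordAlgebra.map_apply_ι, CliffordAlgebra.lift_ι_apply]
  have h1 : coordIsometry (minkSign 10) (minkSign 11) Fin.castSuccEmb (fun _ => rfl) v
      (Fin.last 10) = 0 :=
    coordIsometry_apply_of_ne _ _ _ fun i => (Fin.castSucc_lt_last i).ne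
  have h2 : (fun i : Fin 10 => coordIsometry (minkSign 10) (minkSign 11) Fin.castSuccEmb
      (fun _ => rfl) v i.castSucc) = v :=
    funext fun i => coordIsometry_apply_image (w := minkSign 10) (w' := minkSign 11) Fin.castSuccEmb
      (fun _ => rfl) v i
  simp only [gamma11, LinearMap.mk₂_apply, h1, h2, zero_smul, zero_add, sub_zero]

/-- Two off-diagonal blocks in succession return to the first summand as `σ̄(u)σ(v)`, the product
that defines the `16`. -/
theorem diracTen_inl (g : SpinMink 10) (ψ : Octonion × Octonion) :
    diracTen g (ψ, 0) = (rep16 g ψ, 0) := by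
  refine chiralHom_intertwine (octPauli_mul (by norm_num) (by norm_num))
    (octPauli_mul (by norm_num) (by norm_num)) diracTen (AlgHom.id ℝ _) (LinearMap.inl ℝ _ _) ?_ g ψ
  intro u v m
  simp [diracTen_ι]

theorem diracTen_inr (g : SpinMink 10) (ψ : Octonion × Octonion) :
    diracTen g (0, ψ) = (0, rep16bar g ψ) := by
  refine chiralHom_intertwine (octPauli_mul (by norm_num) (by norm_num))
    (octPauli_mul (by norm_num) (by norm_num)) diracTen (AlgHom.id ℝ _) (LinearMap.inr ℝ _ _) ?_ g ψ
  intro u v m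
  simp [diracTen_ι]

theorem diracTen_apply (g : SpinMink 10) (ψ : (Octonion × Octonion) × (Octonion × Octonion)) :
    diracTen g ψ = (rep16 g ψ.1, rep16bar g ψ.2) := by
  have : ψ = (ψ.1, 0) + (0, ψ.2) := by simp
  rw [this, map_add, diracTen_inl, diracTen_inr]
  simp

/-! ### The action of `SU(2)_L × SU(2)_R` on spinors -/

/-- The coordinates `6, …, 9` of `ℝ^{9,1}`. -/
abbrev inclEucl4 : QuadraticMap.weightedSumSquares ℝ (euclSign 4) →qᵢ
    QuadraticMap.weightedSumSquares ℝ (minkSign 10) :=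
  coordIsometry _ _ (Fin.natAddEmb 6) fun i => if_neg (show 6 + i.val ≠ 0 by omega)

/-- The coordinates `0, …, 5` of `ℝ^{9,1}`. -/
abbrev inclMink6 : QuadraticMap.weightedSumSquares ℝ (minkSign 6) →qᵢ
    QuadraticMap.weightedSumSquares ℝ (minkSign 10) :=
  coordIsometry _ _ (Fin.castLEEmb (by norm_num)) fun _ => rfl

theorem inclEucl4_coords (v : Fin 4 → ℝ) : inclEucl4 v = ![0, 0, 0, 0, 0, 0, v 0, v 1, v 2, v 3] := by
  funext j
  fin_cases j
  all_goals first
    | exact coordIsometry_apply_image (Fin.natAddEmb 6)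
        (fun i => if_neg (show 6 + i.val ≠ 0 by omega)) v 0
    | exact coordIsometry_apply_image (Fin.natAddEmb 6)
        (fun i => if_neg (show 6 + i.val ≠ 0 by omega)) v 1
    | exact coordIsometry_apply_image (Fin.natAddEmb 6)
        (fun i => if_neg (show 6 + i.val ≠ 0 by omega)) v 2
    | exact coordIsometry_apply_image (Fin.natAddEmb 6)
        (fun i => if_neg (show 6 + i.val ≠ 0 by omega)) v 3
    | exact coordIsometry_apply_of_ne (Fin.natAddEmb 6)
        (fun i => if_neg (show 6 + i.val ≠ 0 by omega)) v (fun i h => by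
          have h' : 6 + i.val = _ := congrArg Fin.val h
          simp only at h'
          omega)

/-- The quaternion with given coordinates. -/
abbrev quatVec (v : Fin 4 → ℝ) : Quaternion ℝ := quat (v 0) (v 1) (v 2) (v 3)

/-- A vector `u` in the coordinates `6, …, 9` acts by `(ψ₁, ψ₂) ↦ ((uℓ)ψ₂, -(uℓ)ψ₁)`. -/
theorem diracTen_inclEucl4 (v : Fin 4 → ℝ) (ψ : (Octonion × Octonion) × (Octonion × Octonion)) :
    diracTen (CliffordAlgebra.ι _ (inclEucl4 v)) ψ =
      ((Octonion.mk 0 (quatVec v) * ψ.2.2, -(Octonion.mk 0 (quatVec v) * ψ.2.1)),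
        (Octonion.mk 0 (quatVec v) * ψ.1.2, -(Octonion.mk 0 (quatVec v) * ψ.1.1))) := by
  have h1 : octCoord ![0, 0, 0, 0, 0, 0, v 0, v 1, v 2, v 3] = Octonion.mk 0 (quatVec v) := by
    apply Octonion.ext <;> ext <;> simp [octCoord] <;> rfl
  have h2 : star (Octonion.mk 0 (quatVec v)) = -Octonion.mk 0 (quatVec v) := by
    apply Octonion.ext <;> simp
  rw [diracTen_ι, inclEucl4_coords]
  simp [pauli, h1, h2]

/-- The map `q + pℓ ↦ q b̄ + (a p)ℓ`. -/
def octTwist (a b : Quaternion ℝ) : Octonion →ₗ[ℝ] Octonion where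
  toFun x := Octonion.mk (x.1 * star b) (a * x.2)
  map_add' x y := by apply Octonion.ext <;> simp [add_mul, mul_add]
  map_smul' c x := by apply Octonion.ext <;> simp

theorem octTwist_mul (a b c d : Quaternion ℝ) :
    octTwist a b * octTwist c d = octTwist (a * c) (b * d) :=
  LinearMap.ext fun x => by apply Octonion.ext <;> simp [octTwist, mul_assoc]

/-- The diagonal action of an endomorphism of `𝕆` on `𝕆² ⊕ 𝕆²`. -/
def slotwise : Module.End ℝ Octonion →ₐ[ℝ]
    Module.End ℝ ((Octonion × Octonion) × (Octonion × Octonion)) where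
  toFun f := (f.prodMap f).prodMap (f.prodMap f)
  map_one' := rfl
  map_mul' _ _ := rfl
  map_zero' := rfl
  map_add' _ _ := rfl
  commutes' _ := rfl

/-- `octTwist` on each octonion of a pair of spinors. -/
def diracTwist (a b : Quaternion ℝ) :
    Module.End ℝ ((Octonion × Octonion) × (Octonion × Octonion)) :=
  slotwise (octTwist a b)

theorem diracTwist_apply (a b : Quaternion ℝ)
    (ψ : (Octonion × Octonion) × (Octonion × Octonion)) :
    diracTwist a b ψ = ((octTwist a b ψ.1.1, octTwist a b ψ.1.2),
      (octTwist a b ψ.2.1, octTwist a b ψ.2.2)) :=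
  rfl

theorem octTwist_apply (a b : Quaternion ℝ) (x : Octonion) :
    octTwist a b x = Octonion.mk (x.1 * star b) (a * x.2) :=
  rfl

theorem diracTwist_mul (a b c d : Quaternion ℝ) :
    diracTwist a b * diracTwist c d = diracTwist (a * c) (b * d) := by
  rw [diracTwist, diracTwist, ← map_mul, octTwist_mul, diracTwist]

theorem map_quatInClifford {A B : Type*} [Ring A] [Algebra ℝ A] [Ring B] [Algebra ℝ B]
    (f : A →ₐ[ℝ] B) (a b c d : A) (q : Quaternion ℝ) :
    f (quatInClifford a b c d q) = quatInClifford (f a) (f b) (f c) (f d) q := by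
  simp only [quatInClifford, map_add, map_sub, map_mul, map_smul, map_one]

/-- Applying `q + pℓ ↦ -p̄u + (uq̄)ℓ` twice, for `v` and then for `u`, and including the sign of the
off-diagonal entry, gives `q ↦ q v̄u` and `p ↦ u v̄ p`. The two conjugations undo each other, so the
halves `ℍ` and `ℍℓ` no longer mix. -/
theorem diracTen_gen4_mul_gen4 (i j : Fin 4) :
    diracTen (CliffordAlgebra.map inclEucl4 (gen4 i)) *
      diracTen (CliffordAlgebra.map inclEucl4 (gen4 j)) =
    diracTwist (quatVec (Pi.single i 1) * star (quatVec (Pi.single j 1)))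
      (star (quatVec (Pi.single i 1)) * quatVec (Pi.single j 1)) := by
  refine LinearMap.ext fun ψ => ?_
  rw [Module.End.mul_apply]
  simp only [gen4, cliffordGen, CliffordAlgebra.map_apply_ι, diracTen_inclEucl4]
  refine Prod.ext (Prod.ext ?_ ?_) (Prod.ext ?_ ?_) <;> apply Octonion.ext <;>
    simp [mul_assoc, diracTwist_apply, octTwist_apply]

/-- The volume element of the four directions is `+1` on `ℍ` and `-1` on `ℍℓ`. The projections in
`quatInClifford` hence select `ℍℓ` for `ε = 1` and `ℍ` for `ε = -1`, leaving the identity on the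
other half. -/
theorem diracTen_quat4 {ε : ℝ} (a b : Quaternion ℝ) (q : Quaternion ℝ)
    (h : ε = 1 ∧ a = q ∧ b = 1 ∨ ε = -1 ∧ a = 1 ∧ b = q) :
    diracTen (CliffordAlgebra.map inclEucl4
      (quatInClifford (ε • gen4 0) (gen4 1) (gen4 2) (gen4 3) q)) = diracTwist a b := by
  -- For cyclic directions, `Γ₀Γᵢ` and `ΓⱼΓₖ` have the same left quaternion and opposite right
  -- quaternions. Their sum acts only on `ℍℓ`; reversing the sign of `Γ₀` leaves an action only on
  -- `ℍ`.
  have e1 : quatVec (Pi.single 0 1) * star (quatVec (Pi.single 1 1)) = quat 0 (-1) 0 0 := by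
    ext <;> simp
  have e2 : quatVec (Pi.single 0 1) * star (quatVec (Pi.single 2 1)) = quat 0 0 (-1) 0 := by
    ext <;> simp
  have e3 : quatVec (Pi.single 0 1) * star (quatVec (Pi.single 3 1)) = quat 0 0 0 (-1) := by
    ext <;> simp
  have e4 : quatVec (Pi.single 2 1) * star (quatVec (Pi.single 3 1)) = quat 0 (-1) 0 0 := by
    ext <;> simp
  have e5 : quatVec (Pi.single 3 1) * star (quatVec (Pi.single 1 1)) = quat 0 0 (-1) 0 := by
    ext <;> simp
  have e6 : quatVec (Pi.single 1 1) * star (quatVec (Pi.single 2 1)) = quat 0 0 0 (-1) := by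
    ext <;> simp
  have e1' : star (quatVec (Pi.single 0 1)) * quatVec (Pi.single 1 1) = quat 0 1 0 0 := by
    ext <;> simp
  have e2' : star (quatVec (Pi.single 0 1)) * quatVec (Pi.single 2 1) = quat 0 0 1 0 := by
    ext <;> simp
  have e3' : star (quatVec (Pi.single 0 1)) * quatVec (Pi.single 3 1) = quat 0 0 0 1 := by
    ext <;> simp
  have e4' : star (quatVec (Pi.single 2 1)) * quatVec (Pi.single 3 1) = quat 0 (-1) 0 0 := by
    ext <;> simp
  have e5' : star (quatVec (Pi.single 3 1)) * quatVec (Pi.single 1 1) = quat 0 0 (-1) 0 := by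
    ext <;> simp
  have e6' : star (quatVec (Pi.single 1 1)) * quatVec (Pi.single 2 1) = quat 0 0 0 (-1) := by
    ext <;> simp
  have key : (1 / 2 : ℝ) • (1 + ε • octTwist (quat (-1) 0 0 0) (quat 1 0 0 0)) +
      q.re • (1 / 2 : ℝ) • (1 - ε • octTwist (quat (-1) 0 0 0) (quat 1 0 0 0)) +
      (-q.imI / 2) • (ε • octTwist (quat 0 (-1) 0 0) (quat 0 1 0 0) +
        octTwist (quat 0 (-1) 0 0) (quat 0 (-1) 0 0)) +
      (-q.imJ / 2) • (ε • octTwist (quat 0 0 (-1) 0) (quat 0 0 1 0) +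
        octTwist (quat 0 0 (-1) 0) (quat 0 0 (-1) 0)) +
      (-q.imK / 2) • (ε • octTwist (quat 0 0 0 (-1)) (quat 0 0 0 1) +
        octTwist (quat 0 0 0 (-1)) (quat 0 0 0 (-1))) = octTwist a b := by
    refine LinearMap.ext fun x => ?_
    rcases h with ⟨rfl, rfl, rfl⟩ | ⟨rfl, rfl, rfl⟩ <;> apply Octonion.ext <;> ext <;>
      simp [octTwist, sub_eq_add_neg] <;> ring
  have e7 : quat 0 (-1) 0 0 * quat 0 (-1) 0 0 = quat (-1) 0 0 0 := by ext <;> simp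
  have e8 : quat 0 1 0 0 * quat 0 (-1) 0 0 = quat 1 0 0 0 := by ext <;> simp
  -- Regrouping makes the quartic term a product of two bivectors, so that every term is a twist.
  have e9 (x y z w : Module.End ℝ ((Octonion × Octonion) × (Octonion × Octonion))) :
      x * y * z * w = x * y * (z * w) := mul_assoc _ _ _
  rw [map_quatInClifford, map_quatInClifford, map_smul, map_smul, quatInClifford]
  simp only [smul_mul_assoc]
  rw [e9]
  simp only [diracTen_gen4_mul_gen4, diracTwist_mul, e1, e2, e3, e4, e5, e6,
    e1', e2', e3', e4', e5', e6', e7, e8]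
  simp only [diracTwist]
  rw [← key]
  simp only [map_add, map_sub, map_smul, map_one]

theorem diracTen_su2xsu2 (g : SU2 × SU2) :
    diracTen (CliffordAlgebra.map inclEucl4 (su2xsu2ToSpin4 g)) =
      diracTwist (su2Quat g.1) (su2Quat g.2) := by
  have : ((su2xsu2ToSpin4 g : SpinEucl 4) : CliffordAlgebra _) =
    quatInClifford ((1 : ℝ) • gen4 0) (gen4 1) (gen4 2) (gen4 3) (su2Quat g.1) *
      quatInClifford ((-1 : ℝ) • gen4 0) (gen4 1) (gen4 2) (gen4 3) (su2Quat g.2) := rfl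
  rw [this, map_mul, map_mul, diracTen_quat4 (su2Quat g.1) 1 _ (.inl ⟨rfl, rfl, rfl⟩),
    diracTen_quat4 1 (su2Quat g.2) _ (.inr ⟨rfl, rfl, rfl⟩), diracTwist_mul, mul_one, one_mul]

theorem diracTen_fullHom (gL gR : SU2) (s : SpinMink 6)
    (ψ : (Octonion × Octonion) × (Octonion × Octonion)) :
    diracTen (fullHom (gL, (s, gR))) ψ = diracTen (CliffordAlgebra.map inclMink6 s)
      (diracTwist (su2Quat gL) (su2Quat gR) ψ) := by
  have : ((fullHom (gL, (s, gR)) : SpinMink 10) : CliffordAlgebra _) =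
    CliffordAlgebra.map inclMink6 s * CliffordAlgebra.map inclEucl4 (su2xsu2ToSpin4 (gL, gR)) := rfl
  rw [this, map_mul, diracTen_su2xsu2]
  rfl

/-! ### The vector representation of `SU(2)_L × SU(2)_R` -/

/-- The vector action is read off from the spinor action: `Γ(gv) g = g Γ(v)` is evaluated on one
spinor, which avoids expanding conjugation in the Clifford algebra. -/
theorem quatVec_rep4 (g : SU2 × SU2) (v : Fin 4 → ℝ) :
    quatVec (rep4 g v) = su2Quat g.1 * quatVec v * star (su2Quat g.2) := by
  have h1 := ι_cliffordVecPart_conj (su2xsu2ToSpin4 g) v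
  have h2 : CliffordAlgebra.ι _ (rep4 g v) * (su2xsu2ToSpin4 g).1 =
      (su2xsu2ToSpin4 g).1 * CliffordAlgebra.ι _ v := by
    refine (congrArg (· * (su2xsu2ToSpin4 g).1) h1).trans ?_
    simp only [mul_assoc]
    rw [spinGroup.star_mul_self_of_mem (su2xsu2ToSpin4 g).2, mul_one]
  -- On the octonion `1` in the last slot, the `ℓ` component of the first slot yields `(gv) g_R =
  -- g_L v`.
  have h3 := congrArg (fun x => (diracTen (CliffordAlgebra.map inclEucl4 x)
    ((0, 0), (0, Octonion.mk 1 0))).1.1.2) h2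
  simp only [map_mul, Module.End.mul_apply, diracTen_su2xsu2, CliffordAlgebra.map_apply_ι,
    diracTen_inclEucl4] at h3
  simp [diracTwist_apply, octTwist_apply] at h3
  have h4 : su2Quat g.2 * star (su2Quat g.2) = 1 := by
    rw [Quaternion.self_mul_star, normSq_su2Quat]; rfl
  rw [← h3, mul_assoc, h4, mul_one]

/-! ### Elements of `SU(2)` and of `ℤ₂^A` -/

/-- Supplies elements of `SU(2)` over `i` and `j` for the averaging argument on two-forms. -/
theorem exists_su2Quat (q : Quaternion ℝ) (hq : Quaternion.normSq q = 1) :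
    ∃ g : SU2, su2Quat g = q := by
  refine ⟨⟨!![⟨q.re, q.imI⟩, ⟨q.imJ, q.imK⟩; ⟨-q.imJ, q.imK⟩, ⟨q.re, -q.imI⟩], ?_⟩, ?_⟩
  · rw [Quaternion.normSq_def'] at hq
    rw [Matrix.mem_specialUnitaryGroup_iff, Matrix.mem_unitaryGroup_iff, Matrix.det_fin_two]
    refine ⟨?_, ?_⟩
    · ext i j
      fin_cases i <;> fin_cases j <;> apply Complex.ext <;>
        simp [Matrix.mul_apply, Fin.sum_univ_two, Matrix.star_apply] <;> linarith
    · apply Complex.ext <;> simp <;> linarith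
  · apply Quaternion.ext <;> simp [su2Quat]

/-- At angle `2π` the diagonal entries are `e^{±iπ}`, because `τ¹` carries a factor one half. -/
theorem su2Quat_su2Exp1_two_pi : su2Quat (su2Exp1 (2 * Real.pi)) = -1 := by
  apply Quaternion.ext <;> simp [su2Quat, su2Exp1] <;> rfl

/-- The nontrivial element of `ℤ₂^A`. -/
def z2aGen : Z2A := ⟨su2Exp1 (2 * Real.pi), Subgroup.mem_zpowers _⟩

theorem su2Quat_z2aGen : su2Quat z2aGen = -1 := su2Quat_su2Exp1_two_pi

theorem fixedSpace_le_resZ2A {H V : Type*} [Group H] [AddCommGroup V] [Module ℝ V]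
    (ρ : Representation ℝ (SU2 × H) V) : fixedSpace ρ ≤ fixedSpace (resZ2A ρ) :=
  fun _ hv l => hv l

/-! ### Exterior powers of the vector representation -/

theorem rep4_z2aGen (v : Fin 4 → ℝ) : rep4 (z2aGen, 1) v = (-1 : ℝ) • v := by
  have h := quatVec_rep4 (z2aGen, 1) v
  rw [su2Quat_z2aGen, map_one, star_one, mul_one, neg_one_mul] at h
  have h0 := congrArg QuaternionAlgebra.re h
  have h1 := congrArg QuaternionAlgebra.imI h
  have h2 := congrArg QuaternionAlgebra.imJ h
  have h3 := congrArg QuaternionAlgebra.imK h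
  simp only [quat_re, quat_imI, quat_imJ, quat_imK, Quaternion.re_neg, Quaternion.imI_neg,
    Quaternion.imJ_neg, Quaternion.imK_neg] at h0 h1 h2 h3
  funext i
  fin_cases i <;> simp [h0, h1, h2, h3]

theorem exteriorPower_map_smul {R M : Type*} [CommRing R] [AddCommGroup M] [Module R M] (k : ℕ)
    (f : M →ₗ[R] M) (c : R) (hf : ∀ v, f v = c • v) (x : ⋀[R]^k M) :
    exteriorPower.map k f x = c ^ k • x := by
  have : exteriorPower.map k f = c ^ k • LinearMap.id := by
    refine exteriorPower.linearMap_ext (AlternatingMap.ext fun v => ?_)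
    simp only [LinearMap.compAlternatingMap_apply, exteriorPower.map_apply_ιMulti,
      LinearMap.smul_apply, LinearMap.id_apply]
    have h : (f ∘ v) = fun i => (fun _ => c) i • v i := funext fun i => hf (v i)
    rw [h, AlternatingMap.map_smul_univ]
    simp
  rw [this]; rfl

/-- The generator acts as `(-1)^k = -1`, so a fixed vector equals its own negative. -/
theorem fixedSpace_resZ2A_wedge_odd {k : ℕ} (hk : Odd k) :
    fixedSpace (resZ2A (wedgeRep k rep4)) = ⊥ := by
  rw [eq_bot_iff]
  intro x hx
  have h1 : exteriorPower.map k (rep4 (z2aGen, 1)) x = x := hx z2aGen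
  rw [exteriorPower_map_smul k _ (-1) rep4_z2aGen, hk.neg_one_pow] at h1
  rw [Submodule.mem_bot]
  have h2 : (2 : ℝ) • x = 0 := by
    calc (2 : ℝ) • x = x - (-1 : ℝ) • x := by module
      _ = 0 := by rw [h1, sub_self]
  exact (smul_eq_zero.mp h2).resolve_left two_ne_zero

theorem fixedSpace_wedge_odd {k : ℕ} (hk : Odd k) : fixedSpace (wedgeRep k rep4) = ⊥ :=
  eq_bot_iff.mpr ((fixedSpace_le_resZ2A _).trans (fixedSpace_resZ2A_wedge_odd hk).le)

/-! ### Coordinates on the second exterior power. -/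

theorem ιMulti_two_swap (x y : Fin 4 → ℝ) :
    exteriorPower.ιMulti ℝ 2 ![x, y] = -exteriorPower.ιMulti ℝ 2 ![y, x] := by
  have h := (exteriorPower.ιMulti ℝ 2 (M := Fin 4 → ℝ)).map_swap ![y, x]
    (show (0 : Fin 2) ≠ 1 by decide)
  rw [← h]
  congr 1
  funext i
  fin_cases i <;> rfl

theorem wedge2_swap (i j : Fin 4) : wedge2 i j = -wedge2 j i := ιMulti_two_swap _ _

theorem wedge2_self (i : Fin 4) : wedge2 i i = 0 :=
  AlternatingMap.map_eq_zero_of_eq _ _ (i := 0) (j := 1) rfl (by decide)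

theorem ιMulti_two_sum_left (x y : Fin 4 → ℝ) :
    exteriorPower.ιMulti ℝ 2 ![x, y] =
      ∑ i, x i • exteriorPower.ιMulti ℝ 2 ![Pi.single i 1, y] := by
  have h (z : Fin 4 → ℝ) : exteriorPower.ιMulti ℝ 2 ![z, y] =
      (exteriorPower.ιMulti ℝ 2 (M := Fin 4 → ℝ)).curryLeft z ![y] := rfl
  simp only [h]
  conv_lhs => rw [pi_eq_sum_univ' x]
  simp only [map_sum, map_smul]
  -- Evaluation at `![y]` is packaged as an additive map so that it commutes with the finite sum.
  exact map_sum (⟨⟨fun f => f ![y], rfl⟩, fun _ _ => rfl⟩ :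
    ((Fin 4 → ℝ) [⋀^Fin 1]→ₗ[ℝ] ⋀[ℝ]^2 (Fin 4 → ℝ)) →+ ⋀[ℝ]^2 (Fin 4 → ℝ))
    (fun i => x i • (exteriorPower.ιMulti ℝ 2).curryLeft (Pi.single i 1)) Finset.univ

theorem ιMulti_two_eq (x y : Fin 4 → ℝ) :
    exteriorPower.ιMulti ℝ 2 ![x, y] =
      (x 0 * y 1 - x 1 * y 0) • wedge2 0 1 + (x 0 * y 2 - x 2 * y 0) • wedge2 0 2 +
      (x 0 * y 3 - x 3 * y 0) • wedge2 0 3 + (x 1 * y 2 - x 2 * y 1) • wedge2 1 2 +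
      (x 1 * y 3 - x 3 * y 1) • wedge2 1 3 + (x 2 * y 3 - x 3 * y 2) • wedge2 2 3 := by
  have h (i : Fin 4) : exteriorPower.ιMulti ℝ 2 ![Pi.single i 1, y] = ∑ j, y j • wedge2 i j := by
    rw [ιMulti_two_swap, ιMulti_two_sum_left, ← Finset.sum_neg_distrib]
    exact Finset.sum_congr rfl fun j _ => by rw [wedge2_swap i j, smul_neg]; rfl
  rw [ιMulti_two_sum_left]
  simp only [h, Fin.sum_univ_four, wedge2_self, wedge2_swap 1 0, wedge2_swap 2 0,
    wedge2_swap 3 0, wedge2_swap 2 1, wedge2_swap 3 1, wedge2_swap 3 2]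
  module

theorem exists_wedge2_coords (x : ⋀[ℝ]^2 (Fin 4 → ℝ)) : ∃ a b c d e f : ℝ,
    x = a • wedge2 0 1 + b • wedge2 0 2 + c • wedge2 0 3 + d • wedge2 1 2 + e • wedge2 1 3 +
      f • wedge2 2 3 := by
  have hx : x ∈ Submodule.span ℝ (Set.range (exteriorPower.ιMulti ℝ 2 (M := Fin 4 → ℝ))) := by
    rw [exteriorPower.ιMulti_span]; trivial
  induction hx using Submodule.span_induction with
  | mem x hx =>
    obtain ⟨v, rfl⟩ := hx
    have : v = ![v 0, v 1] := by funext i; fin_cases i <;> rfl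
    rw [this, ιMulti_two_eq]
    exact ⟨_, _, _, _, _, _, rfl⟩
  | zero => exact ⟨0, 0, 0, 0, 0, 0, by simp⟩
  | add x y _ _ hx hy =>
    obtain ⟨a, b, c, d, e, f, rfl⟩ := hx
    obtain ⟨a', b', c', d', e', f', rfl⟩ := hy
    exact ⟨a + a', b + b', c + c', d + d', e + e', f + f', by module⟩
  | smul r x _ hx =>
    obtain ⟨a, b, c, d, e, f, rfl⟩ := hx
    exact ⟨r * a, r * b, r * c, r * d, r * e, r * f, by module⟩

theorem wedgeRep_wedge2 (g : SU2 × SU2) (i j : Fin 4) :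
    wedgeRep 2 rep4 g (wedge2 i j) =
      exteriorPower.ιMulti ℝ 2 ![rep4 g (Pi.single i 1), rep4 g (Pi.single j 1)] := by
  refine (exteriorPower.map_apply_ιMulti _ _).trans ?_
  congr 1
  funext k
  fin_cases k <;> rfl

theorem rep4_left (g : SU2) (v : Fin 4 → ℝ) :
    rep4 (g, 1) v = ![(su2Quat g * quatVec v).re, (su2Quat g * quatVec v).imI,
      (su2Quat g * quatVec v).imJ, (su2Quat g * quatVec v).imK] := by
  have h := quatVec_rep4 (g, 1) v
  simp only [map_one, star_one, mul_one] at h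
  rw [← h]
  funext i
  fin_cases i <;> rfl

/-- The alternating map `(v, w) ↦ v̄ w - w̄ v` into the imaginary quaternions. -/
def imPairing : (Fin 4 → ℝ) [⋀^Fin 2]→ₗ[ℝ] imQuat where
  toFun v := ⟨star (quatVec (v 0)) * quatVec (v 1) - star (quatVec (v 1)) * quatVec (v 0), by
    change QuaternionAlgebra.re _ = 0
    simp
    ring⟩
  map_update_add' v i x y := by
    apply Subtype.ext
    fin_cases i <;> apply Quaternion.ext <;> simp <;> ring
  map_update_smul' v i c x := by
    apply Subtype.ext
    fin_cases i <;> apply Quaternion.ext <;> simp <;> ring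
  map_eq_zero_of_eq' v i j h hij := by
    have h01 : v 0 = v 1 := by
      fin_cases i <;> fin_cases j <;> simp_all
    apply Subtype.ext
    simp [h01]

/-- The map `∧²4 → Im ℍ` induced by `imPairing`. -/
def wedgeToIm : ⋀[ℝ]^2 (Fin 4 → ℝ) →ₗ[ℝ] imQuat :=
  exteriorPower.alternatingMapLinearEquiv imPairing

theorem wedgeToIm_ιMulti (v : Fin 2 → Fin 4 → ℝ) :
    (wedgeToIm (exteriorPower.ιMulti ℝ 2 v) : Quaternion ℝ) =
      star (quatVec (v 0)) * quatVec (v 1) - star (quatVec (v 1)) * quatVec (v 0) := by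
  rw [wedgeToIm, exteriorPower.alternatingMapLinearEquiv_apply_ιMulti]
  rfl

/-- In `v̄w` the left factor enters as `ḡ_L g_L = 1`, and the right factor remains as conjugation.
-/
theorem wedgeToIm_rep (g : SU2 × SU2) (x : ⋀[ℝ]^2 (Fin 4 → ℝ)) :
    wedgeToIm (wedgeRep 2 rep4 g x) = adj3 g.2 (wedgeToIm x) := by
  have hL : star (su2Quat g.1) * su2Quat g.1 = 1 := by
    rw [Quaternion.star_mul_self, normSq_su2Quat]; rfl
  have : wedgeToIm ∘ₗ wedgeRep 2 rep4 g = adj3 g.2 ∘ₗ wedgeToIm := by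
    refine exteriorPower.linearMap_ext (AlternatingMap.ext fun v => Subtype.ext ?_)
    have e1 : wedgeRep 2 rep4 g (exteriorPower.ιMulti ℝ 2 v) =
      exteriorPower.ιMulti ℝ 2 (rep4 g ∘ v) := exteriorPower.map_apply_ιMulti _ _
    have e2 (q : imQuat) : (adj3 g.2 q : Quaternion ℝ) =
      su2Quat g.2 * q * star (su2Quat g.2) := rfl
    simp only [LinearMap.compAlternatingMap_apply, LinearMap.comp_apply, e1, e2, wedgeToIm_ιMulti,
      Function.comp_apply, quatVec_rep4, star_mul, star_star, mul_sub, sub_mul]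
    have e3 (a b : Quaternion ℝ) : su2Quat g.2 * (star a * star (su2Quat g.1)) *
        (su2Quat g.1 * b * star (su2Quat g.2)) = su2Quat g.2 * (star a * b) * star (su2Quat g.2) := by
      calc _ = su2Quat g.2 * (star a * (star (su2Quat g.1) * su2Quat g.1) * b) *
            star (su2Quat g.2) := by simp only [mul_assoc]
        _ = _ := by rw [hL, mul_one]
    rw [e3, e3]
  exact LinearMap.congr_fun this x

/-- The embedding of `Im ℍ` in `∧²4` as two-forms fixed by `SU(2)_L`. -/
def imToWedge : imQuat →ₗ[ℝ] ⋀[ℝ]^2 (Fin 4 → ℝ) where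
  toFun q := (q.1.imI / 2) • ((1 / 2 : ℝ) • wedge2 0 1 - (1 / 2 : ℝ) • wedge2 2 3) +
    (q.1.imJ / 2) • ((1 / 2 : ℝ) • wedge2 0 2 - (1 / 2 : ℝ) • wedge2 3 1) +
    (q.1.imK / 2) • ((1 / 2 : ℝ) • wedge2 0 3 - (1 / 2 : ℝ) • wedge2 1 2)
  map_add' p q := by simp only [Submodule.coe_add, Quaternion.imI_add, Quaternion.imJ_add,
    Quaternion.imK_add]; module
  map_smul' c q := by simp only [Submodule.coe_smul, Quaternion.imI_smul, Quaternion.imJ_smul,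
    Quaternion.imK_smul, smul_eq_mul, RingHom.id_apply]; module

/-- Each generator `½ e₀∧eᵢ - ½ eⱼ∧eₖ` maps to twice the corresponding imaginary unit; this is the
reason for the halved coefficients in `imToWedge`. -/
theorem wedgeToIm_imToWedge (q : imQuat) : wedgeToIm (imToWedge q) = q := by
  have hq : q.1.re = 0 := q.2
  apply Subtype.ext
  simp only [imToWedge, LinearMap.coe_mk, AddHom.coe_mk, map_add, map_sub, map_smul, wedge2,
    Submodule.coe_add, Submodule.coe_sub, Submodule.coe_smul, wedgeToIm_ιMulti]
  apply Quaternion.ext <;> simp [hq] <;> ring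

/-- The coefficients of the transformed forms are quadratic in the coordinates of the quaternion,
and they differ from the original ones by multiples of `|g|² - 1`. -/
theorem wedge_generators_fixed (g : SU2) :
    wedgeRep 2 rep4 (g, 1) ((1 / 2 : ℝ) • wedge2 0 1 - (1 / 2 : ℝ) • wedge2 2 3) =
      (1 / 2 : ℝ) • wedge2 0 1 - (1 / 2 : ℝ) • wedge2 2 3 ∧
    wedgeRep 2 rep4 (g, 1) ((1 / 2 : ℝ) • wedge2 0 2 - (1 / 2 : ℝ) • wedge2 3 1) =
      (1 / 2 : ℝ) • wedge2 0 2 - (1 / 2 : ℝ) • wedge2 3 1 ∧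
    wedgeRep 2 rep4 (g, 1) ((1 / 2 : ℝ) • wedge2 0 3 - (1 / 2 : ℝ) • wedge2 1 2) =
      (1 / 2 : ℝ) • wedge2 0 3 - (1 / 2 : ℝ) • wedge2 1 2 := by
  have hn := normSq_su2Quat g
  rw [Quaternion.normSq_def'] at hn
  simp only [map_sub, map_smul, wedgeRep_wedge2, ιMulti_two_eq, rep4_left]
  simp only [wedge2_swap 3 1]
  refine ⟨?_, ?_, ?_⟩ <;> simp <;> match_scalars <;> first
    | ring1
    | linear_combination (1 / 2) * hn
    | linear_combination (-1 / 2) * hn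

/-- Invariance under the elements `i` and `j` is all that is needed. -/
theorem imToWedge_wedgeToIm {x : ⋀[ℝ]^2 (Fin 4 → ℝ)} (hx : x ∈ fixedSpace (wedgeRep 2 rep4)) :
    imToWedge (wedgeToIm x) = x := by
  obtain ⟨gI, hI⟩ := exists_su2Quat (quat 0 1 0 0) (by simp [Quaternion.normSq_def'])
  obtain ⟨gJ, hJ⟩ := exists_su2Quat (quat 0 0 1 0) (by simp [Quaternion.normSq_def'])
  have h1 : wedgeRep 2 rep4 (gI, 1) x = x := hx gI
  have h2 : wedgeRep 2 rep4 (gJ, 1) x = x := hx gJ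
  -- The average over `1, i, j, ji`: since `-1` acts trivially on two-forms, this is the projection
  -- onto the forms fixed by the quaternion group.
  have h3 : x = (1 / 4 : ℝ) • (x + wedgeRep 2 rep4 (gI, 1) x +
      wedgeRep 2 rep4 (gJ, 1) (x + wedgeRep 2 rep4 (gI, 1) x)) := by
    rw [h1, map_add, h2]; module
  -- From here the claim is that this average equals `imToWedge ∘ wedgeToIm` on every two-form, so
  -- invariance of `x` is no longer needed and six coordinates suffice.
  clear h1 h2 hx
  conv_rhs => rw [h3]
  clear h3
  obtain ⟨a, b, c, d, e, f, rfl⟩ := exists_wedge2_coords x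
  have key (i j : Fin 4) : (wedgeToIm (wedge2 i j) : Quaternion ℝ) = _ := wedgeToIm_ιMulti _
  simp only [map_add, map_smul, wedgeRep_wedge2, ιMulti_two_eq, rep4_left, hI, hJ]
  simp [imToWedge, key, wedge2_swap 3 1]
  module

theorem fixedSpace_wedge2 : fixedSpace (wedgeRep 2 rep4) = Submodule.span ℝ
    {(1 / 2 : ℝ) • wedge2 0 1 - (1 / 2 : ℝ) • wedge2 2 3,
      (1 / 2 : ℝ) • wedge2 0 2 - (1 / 2 : ℝ) • wedge2 3 1,
      (1 / 2 : ℝ) • wedge2 0 3 - (1 / 2 : ℝ) • wedge2 1 2} := by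
  apply le_antisymm
  · intro x hx
    rw [← imToWedge_wedgeToIm hx]
    refine add_mem (add_mem ?_ ?_) ?_ <;>
      exact Submodule.smul_mem _ _ (Submodule.subset_span (by simp))
  · rw [Submodule.span_le]
    rintro x (rfl | rfl | rfl) g
    · exact (wedge_generators_fixed g).1
    · exact (wedge_generators_fixed g).2.1
    · exact (wedge_generators_fixed g).2.2

theorem imToWedge_mem (q : imQuat) : imToWedge q ∈ fixedSpace (wedgeRep 2 rep4) := by
  rw [fixedSpace_wedge2]
  refine add_mem (add_mem ?_ ?_) ?_ <;>
    exact Submodule.smul_mem _ _ (Submodule.subset_span (by simp))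

/-- The `SU(2)_L`-fixed part of `∧²4` is the adjoint representation of `SU(2)_R`. -/
def fixedWedgeEquiv : (fixedRep (wedgeRep 2 rep4)).Equiv adj3 :=
  Representation.Equiv.mk
    { toLinearMap := wedgeToIm ∘ₗ (fixedSpace (wedgeRep 2 rep4)).subtype
      invFun := fun q => ⟨imToWedge q, imToWedge_mem q⟩
      left_inv := fun x => Subtype.ext (imToWedge_wedgeToIm x.2)
      right_inv := wedgeToIm_imToWedge }
    fun g => LinearMap.ext fun x => wedgeToIm_rep (1, g) x

/-! ### The quaternionic subspace -/

theorem mem_range_quatToOct {ψ : Octonion × Octonion} :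
    ψ ∈ LinearMap.range quatToOct ↔ ψ.1.2 = 0 ∧ ψ.2.2 = 0 := by
  constructor
  · rintro ⟨φ, rfl⟩
    exact ⟨rfl, rfl⟩
  · rintro ⟨h1, h2⟩
    exact ⟨(ψ.1.1, ψ.2.1), Prod.ext (Octonion.ext rfl h1.symm) (Octonion.ext rfl h2.symm)⟩

theorem quatToOct_injective : Function.Injective quatToOct := fun _ _ h =>
  Prod.ext (congrArg (fun x => x.1.1) h) (congrArg (fun x => x.2.1) h)

theorem inclMink6_coords (v : Fin 6 → ℝ) :
    inclMink6 v = ![v 0, v 1, v 2, v 3, v 4, v 5, 0, 0, 0, 0] := by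
  have h (i : Fin 6) : inclMink6 v (Fin.castLEEmb (by norm_num) i) = v i :=
    coordIsometry_apply_image (w := minkSign 6) (w' := minkSign 10) _ (fun _ => rfl) v i
  have h' (j : Fin 10) (hj : 6 ≤ j.val) : inclMink6 v j = 0 :=
    coordIsometry_apply_of_ne _ _ v fun i hi => by
      have : i.val = j.val := congrArg Fin.val hi
      omega
  funext j
  fin_cases j
  · exact h 0
  · exact h 1
  · exact h 2
  · exact h 3
  · exact h 4
  · exact h 5
  all_goals exact h' _ (by decide)

/-- The entries of the matrix lie in the subalgebra `ℍ`, where octonion multiplication is that of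
quaternions. -/
theorem pauli_quatToOct (ε : ℝ) (v : Fin 6 → ℝ) (φ : Quaternion ℝ × Quaternion ℝ) :
    pauli octCoord ε (inclMink6 v) (quatToOct φ) = quatToOct (pauli quatCoord ε v φ) := by
  have h1 : octCoord ![v 0, v 1, v 2, v 3, v 4, v 5, 0, 0, 0, 0] =
      Octonion.mk (quatCoord v) 0 := by
    apply Octonion.ext <;> ext <;> simp [octCoord, quatCoord] <;> rfl
  rw [inclMink6_coords]
  refine Prod.ext ?_ ?_ <;> apply Octonion.ext <;> simp [pauli, h1, quatToOct]

theorem diracTen_inclMink6_inl (s : SpinMink 6) (φ : Quaternion ℝ × Quaternion ℝ) :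
    diracTen (CliffordAlgebra.map inclMink6 s) (quatToOct φ, 0) = (quatToOct (rep8 s φ), 0) := by
  refine chiralHom_intertwine (quatPauli_mul (by norm_num) (by norm_num))
    (quatPauli_mul (by norm_num) (by norm_num)) (diracTen.comp (CliffordAlgebra.map inclMink6))
    (AlgHom.id ℝ _) (LinearMap.inl ℝ _ _ ∘ₗ quatToOct) ?_ s φ
  intro u v m
  simp only [AlgHom.comp_apply, CliffordAlgebra.map_apply_ι, LinearMap.comp_apply,
    LinearMap.inl_apply, diracTen_ι, map_zero, pauli_quatToOct]
  rfl

theorem diracTen_inclMink6_inr (s : SpinMink 6) (φ : Quaternion ℝ × Quaternion ℝ) :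
    diracTen (CliffordAlgebra.map inclMink6 s) (0, quatToOct φ) =
      (0, quatToOct (rep8bar s φ)) := by
  refine chiralHom_intertwine (quatPauli_mul (by norm_num) (by norm_num))
    (quatPauli_mul (by norm_num) (by norm_num)) (diracTen.comp (CliffordAlgebra.map inclMink6))
    (AlgHom.id ℝ _) (LinearMap.inr ℝ _ _ ∘ₗ quatToOct) ?_ s φ
  intro u v m
  simp only [AlgHom.comp_apply, CliffordAlgebra.map_apply_ι, LinearMap.comp_apply,
    LinearMap.inr_apply, diracTen_ι, map_zero, pauli_quatToOct]
  rfl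

theorem octTwist_one_one (x : Octonion) : octTwist 1 1 x = x := by
  apply Octonion.ext <;> simp [octTwist_apply]

theorem diracTwist_one_one : diracTwist 1 1 = 1 := by
  refine LinearMap.ext fun ψ => ?_
  simp [diracTwist_apply, octTwist_one_one]

theorem diracTen_fullHom_spin51 (s : SpinMink 6)
    (ψ : (Octonion × Octonion) × (Octonion × Octonion)) :
    diracTen (fullHom (1, (s, 1))) ψ = diracTen (CliffordAlgebra.map inclMink6 s) ψ := by
  rw [diracTen_fullHom, map_one, diracTwist_one_one]
  rfl

theorem rep16_quatToOct (s : SpinMink 6) (φ : Quaternion ℝ × Quaternion ℝ) :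
    quatToOct (rep8 s φ) = rep16 (fullHom (1, (s, 1))) (quatToOct φ) := by
  have h := diracTen_inl (fullHom (1, (s, 1))) (quatToOct φ)
  rw [diracTen_fullHom_spin51, diracTen_inclMink6_inl] at h
  exact congrArg Prod.fst h

theorem rep16bar_quatToOct (s : SpinMink 6) (φ : Quaternion ℝ × Quaternion ℝ) :
    quatToOct (rep8bar s φ) = rep16bar (fullHom (1, (s, 1))) (quatToOct φ) := by
  have h := diracTen_inr (fullHom (1, (s, 1))) (quatToOct φ)
  rw [diracTen_fullHom_spin51, diracTen_inclMink6_inr] at h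
  exact congrArg Prod.snd h

/-! ### Fixed subspaces of the spinor representations -/

theorem diracTen_fullHom_left (g : SU2) (ψ : (Octonion × Octonion) × (Octonion × Octonion)) :
    diracTen (fullHom (g, 1)) ψ = diracTwist (su2Quat g) 1 ψ := by
  have h := diracTen_fullHom g 1 1 ψ
  rw [map_one] at h
  exact h.trans (by rw [OneMemClass.coe_one, map_one, map_one]; rfl)

theorem rep16_fullHom_left (g : SU2) (ψ : Octonion × Octonion) :
    rep16 (fullHom (g, 1)) ψ = (octTwist (su2Quat g) 1 ψ.1, octTwist (su2Quat g) 1 ψ.2) := by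
  have h := diracTen_inl (fullHom (g, 1)) ψ
  rw [diracTen_fullHom_left] at h
  exact (congrArg Prod.fst h).symm

theorem rep16bar_fullHom_left (g : SU2) (ψ : Octonion × Octonion) :
    rep16bar (fullHom (g, 1)) ψ = (octTwist (su2Quat g) 1 ψ.1, octTwist (su2Quat g) 1 ψ.2) := by
  have h := diracTen_inr (fullHom (g, 1)) ψ
  rw [diracTen_fullHom_left] at h
  exact (congrArg Prod.snd h).symm

theorem octTwist_neg_one_eq_self {x : Octonion} (h : octTwist (-1) 1 x = x) : x.2 = 0 := by
  have h1 : -x.2 = x.2 := by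
    simpa [octTwist_apply] using congrArg (fun y : Octonion => y.2) h
  have h2 : (2 : ℝ) • x.2 = 0 := by
    calc (2 : ℝ) • x.2 = x.2 - -x.2 := by module
      _ = 0 := by rw [h1, sub_self]
  exact (smul_eq_zero.mp h2).resolve_left two_ne_zero

theorem octTwist_one_right_eq_self {x : Octonion} (h : x.2 = 0) (a : Quaternion ℝ) :
    octTwist a 1 x = x := by
  apply Octonion.ext <;> simp [octTwist_apply, h]

/-- A circle of inclusions: `ℤ₂^A` already kills the `ℓ` components, vectors without them are fixed
by `SU(2)_L`, and these are in turn fixed by the subgroup. -/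
theorem fixedSpace_eq_range_quatToOct
    {ρ : Representation ℝ (SU2 × (SpinMink 6 × SU2)) (Octonion × Octonion)}
    (hρ : ∀ g ψ, ρ (g, 1) ψ = (octTwist (su2Quat g) 1 ψ.1, octTwist (su2Quat g) 1 ψ.2)) :
    fixedSpace (resZ2A ρ) = LinearMap.range quatToOct ∧
      fixedSpace ρ = LinearMap.range quatToOct := by
  have h1 : fixedSpace (resZ2A ρ) ≤ LinearMap.range quatToOct := by
    intro ψ hψ
    have h : ρ (z2aGen, 1) ψ = ψ := hψ z2aGen
    rw [hρ, su2Quat_z2aGen] at h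
    exact mem_range_quatToOct.mpr ⟨octTwist_neg_one_eq_self (congrArg Prod.fst h),
      octTwist_neg_one_eq_self (congrArg Prod.snd h)⟩
  have h2 : LinearMap.range quatToOct ≤ fixedSpace ρ := by
    intro ψ hψ g
    obtain ⟨e1, e2⟩ := mem_range_quatToOct.mp hψ
    refine (hρ g ψ).trans ?_
    rw [octTwist_one_right_eq_self e1, octTwist_one_right_eq_self e2]
  exact ⟨le_antisymm h1 (h2.trans (fixedSpace_le_resZ2A ρ)),
    le_antisymm ((fixedSpace_le_resZ2A ρ).trans h1) h2⟩

theorem fixedSpace_rep32 :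
    fixedSpace (resZ2A ((rep32.comp spin91to101).comp fullHom)) =
        LinearMap.range (quatToOct.prodMap quatToOct) ∧
      fixedSpace ((rep32.comp spin91to101).comp fullHom) =
        LinearMap.range (quatToOct.prodMap quatToOct) := by
  set ρ : Representation ℝ (SU2 × (SpinMink 6 × SU2)) _ := (rep32.comp spin91to101).comp fullHom
  -- The restriction of the `32` to `Spin(9,1)` is `diracTen` by definition.
  have hρ (g ψ) : ρ (g, 1) ψ = diracTwist (su2Quat g) 1 ψ := diracTen_fullHom_left g ψ
  have h1 : fixedSpace (resZ2A ρ) ≤ LinearMap.range (quatToOct.prodMap quatToOct) := by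
    intro ψ hψ
    have h : ρ (z2aGen, 1) ψ = ψ := hψ z2aGen
    rw [hρ, su2Quat_z2aGen] at h
    rw [LinearMap.range_prodMap]
    exact ⟨mem_range_quatToOct.mpr ⟨octTwist_neg_one_eq_self (congrArg (fun x => x.1.1) h),
        octTwist_neg_one_eq_self (congrArg (fun x => x.1.2) h)⟩,
      mem_range_quatToOct.mpr ⟨octTwist_neg_one_eq_self (congrArg (fun x => x.2.1) h),
        octTwist_neg_one_eq_self (congrArg (fun x => x.2.2) h)⟩⟩
  have h2 : LinearMap.range (quatToOct.prodMap quatToOct) ≤ fixedSpace ρ := by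
    intro ψ hψ g
    rw [LinearMap.range_prodMap] at hψ
    obtain ⟨e1, e2⟩ := mem_range_quatToOct.mp hψ.1
    obtain ⟨e3, e4⟩ := mem_range_quatToOct.mp hψ.2
    refine (hρ g ψ).trans ?_
    rw [diracTwist_apply, octTwist_one_right_eq_self e1, octTwist_one_right_eq_self e2,
      octTwist_one_right_eq_self e3, octTwist_one_right_eq_self e4]
  exact ⟨le_antisymm h1 (h2.trans (fixedSpace_le_resZ2A ρ)),
    le_antisymm ((fixedSpace_le_resZ2A ρ).trans h1) h2⟩

/-! ### Branching to `Spin(3,1) × U(1)_V × SU(2)_R` -/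

/-- The decomposition `ℍ² = ℂ²j ⊕ ℂ²`, in the form `a ↦ a₀ j - a₁`. -/
def compPairToQuat : (Fin 2 → Fin 2 → ℂ) ≃ₗ[ℝ] Quaternion ℝ × Quaternion ℝ where
  toFun a := (compQuat (-(a 1 0)) (a 0 0), compQuat (-(a 1 1)) (a 0 1))
  map_add' a b := by ext <;> simp [compQuat] <;> ring
  map_smul' c a := by ext <;> simp [compQuat]
  invFun φ := ![![⟨φ.1.imJ, φ.1.imK⟩, ⟨φ.2.imJ, φ.2.imK⟩],
    ![⟨-φ.1.re, -φ.1.imI⟩, ⟨-φ.2.re, -φ.2.imI⟩]]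
  left_inv a := by
    funext i j
    fin_cases i <;> fin_cases j <;> apply Complex.ext <;> simp [compQuat]
  right_inv φ := by
    refine Prod.ext ?_ ?_ <;> apply Quaternion.ext <;> simp [compQuat]

/-- For `h = z + wj`, the relation `jz̄ = zj` gives `(a₀j - a₁)(z̄ - wj) = (za₀ + wa₁)j - (-w̄a₀ +
z̄a₁)`. The choice `a₀j - a₁` is thus what makes the rows of the matrix of `h` appear. -/
theorem octTwist_compPairToQuat (h : SU2) (a : Fin 2 → Fin 2 → ℂ) :
    (octTwist 1 (su2Quat h) (quatToOct (compPairToQuat a)).1,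
      octTwist 1 (su2Quat h) (quatToOct (compPairToQuat a)).2) =
    quatToOct (compPairToQuat fun i => ∑ j, h.1 i j • a j) := by
  obtain ⟨e1, e2, -⟩ := su2_entries h
  refine Prod.ext ?_ ?_ <;> apply Octonion.ext <;> ext <;>
    simp [octTwist_apply, quatToOct, compPairToQuat, compQuat, su2Quat, e1, e2,
      Fin.sum_univ_two] <;> ring

/-- The coordinates `0, …, 3` of `ℝ^{5,1}`. -/
abbrev inclMink4 : QuadraticMap.weightedSumSquares ℝ (minkSign 4) →qᵢ
    QuadraticMap.weightedSumSquares ℝ (minkSign 6) :=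
  coordIsometry _ _ (Fin.castLEEmb (by norm_num)) fun _ => rfl

/-- The coordinates `4, 5` of `ℝ^{5,1}`. -/
abbrev inclEucl2 : QuadraticMap.weightedSumSquares ℝ (euclSign 2) →qᵢ
    QuadraticMap.weightedSumSquares ℝ (minkSign 6) :=
  coordIsometry _ _ (Fin.natAddEmb 4) fun i => if_neg (show 4 + i.val ≠ 0 by omega)

theorem inclMink4_coords (v : Fin 4 → ℝ) : inclMink4 v = ![v 0, v 1, v 2, v 3, 0, 0] := by
  have h (i : Fin 4) : inclMink4 v (Fin.castLEEmb (by norm_num) i) = v i :=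
    coordIsometry_apply_image (w := minkSign 4) (w' := minkSign 6) _ (fun _ => rfl) v i
  have h' (j : Fin 6) (hj : 4 ≤ j.val) : inclMink4 v j = 0 :=
    coordIsometry_apply_of_ne _ _ v fun i hi => by
      have : i.val = j.val := congrArg Fin.val hi
      omega
  funext j
  fin_cases j
  · exact h 0
  · exact h 1
  · exact h 2
  · exact h 3
  all_goals exact h' _ (by decide)

theorem inclEucl2_coords (v : Fin 2 → ℝ) : inclEucl2 v = ![0, 0, 0, 0, v 0, v 1] := by
  have h (i : Fin 2) : inclEucl2 v (Fin.natAddEmb 4 i) = v i :=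
    coordIsometry_apply_image (w := euclSign 2) (w' := minkSign 6) _ _ v i
  have h' (j : Fin 6) (hj : j.val < 4) : inclEucl2 v j = 0 :=
    coordIsometry_apply_of_ne _ _ v fun i hi => by
      have : 4 + i.val = j.val := congrArg Fin.val hi
      omega
  funext j
  fin_cases j
  iterate 4 exact h' _ (by decide)
  · exact h 0
  · exact h 1

theorem diracTen_inclMink6_ι (v : Fin 6 → ℝ) (φ φ' : Quaternion ℝ × Quaternion ℝ) :
    diracTen (CliffordAlgebra.map inclMink6 (CliffordAlgebra.ι _ v))
      (quatToOct φ, quatToOct φ') =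
      (quatToOct (pauli quatCoord (-1) v φ'), quatToOct (pauli quatCoord 1 v φ)) := by
  rw [CliffordAlgebra.map_apply_ι, diracTen_ι, pauli_quatToOct, pauli_quatToOct]

/-- The time coordinate vanishes, so `ε` drops out; both chiralities consequently have the same
`U(1)_V` charge. -/
theorem pauli_inclEucl2 (ε : ℝ) (v : Fin 2 → ℝ) (φ : Quaternion ℝ × Quaternion ℝ) :
    pauli quatCoord ε (inclEucl2 v) φ =
      (quat 0 0 (v 0) (v 1) * φ.2, -(quat 0 0 (v 0) (v 1) * φ.1)) := by
  have h1 : quatCoord ![0, 0, 0, 0, v 0, v 1] = quat 0 0 (v 0) (v 1) := by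
    ext <;> simp [quatCoord]
  have h2 : star (quat 0 0 (v 0) (v 1)) = -quat 0 0 (v 0) (v 1) := by ext <;> simp
  rw [inclEucl2_coords]
  simp [pauli, h1, h2]

/-- Since `jk = i` and one off-diagonal entry carries a sign, `Γ₄Γ₅` is left multiplication by `-i`.
This is the origin of the charge `-1`. -/
theorem diracTen_rotation (c s : ℝ) (φ φ' : Quaternion ℝ × Quaternion ℝ) :
    diracTen (CliffordAlgebra.map inclMink6 (CliffordAlgebra.map inclEucl2
      (algebraMap ℝ _ c + s • (CliffordAlgebra.ι _ (Pi.single 0 1) *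
        CliffordAlgebra.ι _ (Pi.single 1 1))))) (quatToOct φ, quatToOct φ') =
    (quatToOct (quat c (-s) 0 0 * φ.1, quat c (-s) 0 0 * φ.2),
      quatToOct (quat c (-s) 0 0 * φ'.1, quat c (-s) 0 0 * φ'.2)) := by
  simp only [map_add, map_smul, map_mul, AlgHom.commutes, CliffordAlgebra.map_apply_ι inclEucl2,
    LinearMap.add_apply, LinearMap.smul_apply, Module.End.mul_apply, diracTen_inclMink6_ι,
    pauli_inclEucl2, Module.algebraMap_end_apply]
  simp only [Prod.smul_mk, Prod.mk_add_mk, ← map_smul, ← map_add]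
  refine Prod.ext (congrArg quatToOct ?_) (congrArg quatToOct ?_) <;> ext <;> simp

theorem diracTen_circle (z : Circle) (a b : Fin 2 → Fin 2 → ℂ) :
    diracTen (CliffordAlgebra.map inclMink6 (CliffordAlgebra.map inclEucl2 (circleToSpin2 z)))
      (quatToOct (compPairToQuat a), quatToOct (compPairToQuat b)) =
    (quatToOct (compPairToQuat (((z⁻¹ : Circle) : ℂ) • a)),
      quatToOct (compPairToQuat (((z⁻¹ : Circle) : ℂ) • b))) := by
  refine (diracTen_rotation (z : ℂ).re (z : ℂ).im _ _).trans ?_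
  refine Prod.ext (congrArg quatToOct ?_) (congrArg quatToOct ?_) <;> ext <;>
    simp [compPairToQuat, compQuat] <;> ring

/-- The real action of complex matrices on `ℂ²`. -/
def matrixToEndReal : Matrix (Fin 2) (Fin 2) ℂ →ₐ[ℝ] Module.End ℝ (Fin 2 → ℂ) where
  toFun A := (Matrix.toLinAlgEquiv (R := ℂ) (Pi.basisFun ℂ (Fin 2)) A).restrictScalars ℝ
  map_one' := by rw [map_one]; rfl
  map_mul' A B := by rw [map_mul]; rfl
  map_zero' := by rw [map_zero]; rfl
  map_add' A B := by rw [map_add]; rfl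
  commutes' r := by
    have : algebraMap ℝ (Matrix (Fin 2) (Fin 2) ℂ) r = algebraMap ℂ _ (r : ℂ) := rfl
    rw [this, AlgEquiv.commutes]
    ext ψ i
    simp

theorem matrixToEndReal_apply (A : Matrix (Fin 2) (Fin 2) ℂ) (ψ : Fin 2 → ℂ) :
    matrixToEndReal A ψ = A.mulVec ψ := by
  change Matrix.toLin (Pi.basisFun ℂ (Fin 2)) (Pi.basisFun ℂ (Fin 2)) A ψ = _
  rw [Matrix.toLin_eq_toLin', Matrix.toLin'_apply]

theorem weyl_apply (g : SpinMink 4) (ψ : Fin 2 → ℂ) : weyl g ψ =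
    matrixToEndReal (chiralHom _ (cpauli (-1)) (cpauli 1)
      (cpauli_mul (by norm_num) (by norm_num)) (cpauli_mul (by norm_num) (by norm_num)) g) ψ :=
  rfl

theorem weylBar_apply (g : SpinMink 4) (ψ : Fin 2 → ℂ) : weylBar g ψ =
    matrixToEndReal (chiralHom _ (cpauli 1) (cpauli (-1))
      (cpauli_mul (by norm_num) (by norm_num)) (cpauli_mul (by norm_num) (by norm_num)) g) ψ :=
  rfl

/-- The embedding `ψ ↦ ψ c` of `ℂ²` in `ℍ²`. -/
def compToQuat (c : Quaternion ℝ) : (Fin 2 → ℂ) →ₗ[ℝ] Quaternion ℝ × Quaternion ℝ where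
  toFun ψ := (compQuat (ψ 0) 0 * c, compQuat (ψ 1) 0 * c)
  map_add' ψ φ := by ext <;> simp [compQuat] <;> ring
  map_smul' r ψ := by ext <;> simp [compQuat] <;> ring

theorem compPairToQuat_eq (a : Fin 2 → Fin 2 → ℂ) :
    compPairToQuat a = compToQuat (quat 0 0 1 0) (a 0) + compToQuat (quat (-1) 0 0 0) (a 1) := by
  refine Prod.ext ?_ ?_ <;> ext <;> simp [compPairToQuat, compToQuat, compQuat]

/-- For vectors in the coordinates 0 to 3 the matrix entries are complex and act from the left, so
by associativity a quaternion multiplied on the right is inert. Both `ψj` and `-ψ` therefore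
transform as Weyl spinors. -/
theorem pauli_compToQuat (ε : ℝ) (v : Fin 4 → ℝ) (c : Quaternion ℝ) (ψ : Fin 2 → ℂ) :
    pauli quatCoord ε (inclMink4 v) (compToQuat c ψ) =
      compToQuat c (matrixToEndReal (cpauli ε v) ψ) := by
  have h1 : quatCoord ![v 0, v 1, v 2, v 3, 0, 0] = quat (v 2) (v 3) 0 0 := by
    ext <;> simp [quatCoord]
  rw [inclMink4_coords, matrixToEndReal_apply]
  refine Prod.ext ?_ ?_ <;> ext <;>
    simp [pauli, h1, compToQuat, compQuat, cpauli, dotProduct, Fin.sum_univ_two] <;>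
    ring

theorem diracTen_weyl (g : SpinMink 4) (c : Quaternion ℝ) (ψ : Fin 2 → ℂ) :
    diracTen (CliffordAlgebra.map inclMink6 (CliffordAlgebra.map inclMink4 g))
      (quatToOct (compToQuat c ψ), 0) = (quatToOct (compToQuat c (weyl g ψ)), 0) := by
  rw [weyl_apply]
  refine chiralHom_intertwine _ _
    ((diracTen.comp (CliffordAlgebra.map inclMink6)).comp (CliffordAlgebra.map inclMink4))
    matrixToEndReal (LinearMap.inl ℝ _ _ ∘ₗ quatToOct ∘ₗ compToQuat c) ?_ g ψ
  intro u v m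
  rw [map_mul]
  simp only [AlgHom.comp_apply, CliffordAlgebra.map_apply_ι, LinearMap.comp_apply,
    LinearMap.inl_apply, diracTen_ι, map_zero, pauli_quatToOct, pauli_compToQuat,
    Module.End.mul_apply]

theorem diracTen_weylBar (g : SpinMink 4) (c : Quaternion ℝ) (ψ : Fin 2 → ℂ) :
    diracTen (CliffordAlgebra.map inclMink6 (CliffordAlgebra.map inclMink4 g))
      (0, quatToOct (compToQuat c ψ)) = (0, quatToOct (compToQuat c (weylBar g ψ))) := by
  rw [weylBar_apply]
  refine chiralHom_intertwine _ _
    ((diracTen.comp (CliffordAlgebra.map inclMink6)).comp (CliffordAlgebra.map inclMink4))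
    matrixToEndReal (LinearMap.inr ℝ _ _ ∘ₗ quatToOct ∘ₗ compToQuat c) ?_ g ψ
  intro u v m
  rw [map_mul]
  simp only [AlgHom.comp_apply, CliffordAlgebra.map_apply_ι, LinearMap.comp_apply,
    LinearMap.inr_apply, diracTen_ι, map_zero, pauli_quatToOct, pauli_compToQuat,
    Module.End.mul_apply]

theorem diracTen_spin31 (g : SpinMink 4) (a b : Fin 2 → Fin 2 → ℂ) :
    diracTen (CliffordAlgebra.map inclMink6 (CliffordAlgebra.map inclMink4 g))
      (quatToOct (compPairToQuat a), quatToOct (compPairToQuat b)) =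
    (quatToOct (compPairToQuat fun i => weyl g (a i)),
      quatToOct (compPairToQuat fun i => weylBar g (b i))) := by
  have h : (quatToOct (compPairToQuat a), quatToOct (compPairToQuat b)) =
      (quatToOct (compToQuat (quat 0 0 1 0) (a 0)), 0) +
      (quatToOct (compToQuat (quat (-1) 0 0 0) (a 1)), 0) +
      ((0, quatToOct (compToQuat (quat 0 0 1 0) (b 0))) +
      (0, quatToOct (compToQuat (quat (-1) 0 0 0) (b 1)))) := by
    simp [compPairToQuat_eq]
  rw [h]
  simp only [map_add, diracTen_weyl, diracTen_weylBar]
  simp [compPairToQuat_eq]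

/-- Treats both chiralities at once: `b = 0` gives the branching of the `16`, `a = 0` that of its
conjugate, and general `a, b` that of the `32`. -/
theorem diracTen_residual (g : SpinMink 4) (z : Circle) (h : SU2) (a b : Fin 2 → Fin 2 → ℂ) :
    diracTen (fullHom (1, residualHom (g, (z, h))))
      (quatToOct (compPairToQuat a), quatToOct (compPairToQuat b)) =
    (quatToOct (compPairToQuat fun i => weyl g (((z⁻¹ : Circle) : ℂ) • ∑ j, h.1 i j • a j)),
      quatToOct (compPairToQuat fun i =>
        weylBar g (((z⁻¹ : Circle) : ℂ) • ∑ j, h.1 i j • b j))) := by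
  have h1 : ((spin31x2 (g, circleToSpin2 z) : SpinMink 6) : CliffordAlgebra _) =
    CliffordAlgebra.map inclMink4 g * CliffordAlgebra.map inclEucl2 (circleToSpin2 z) := rfl
  refine (diracTen_fullHom 1 h (spin31x2 (g, circleToSpin2 z)) _).trans ?_
  have h2 : diracTwist (su2Quat 1) (su2Quat h)
      (quatToOct (compPairToQuat a), quatToOct (compPairToQuat b)) =
      (quatToOct (compPairToQuat fun i => ∑ j, h.1 i j • a j),
        quatToOct (compPairToQuat fun i => ∑ j, h.1 i j • b j)) := by
    rw [map_one]
    exact Prod.ext (octTwist_compPairToQuat h a) (octTwist_compPairToQuat h b)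
  rw [h2, h1, map_mul, map_mul, Module.End.mul_apply, diracTen_circle, diracTen_spin31]
  rfl

/-! ### Tensoring with the charge and the doublet. -/

section Branching

variable {V W G : Type*} [AddCommGroup V] [Module ℂ V] [AddCommGroup W] [Module ℝ W] [Group G]

/-- `V ⊗ (ℂ ⊗ ℂ²)` as pairs of elements of `V`. -/
def tensorPairEquiv (V : Type*) [AddCommGroup V] [Module ℂ V] :
    V ⊗[ℂ] (ℂ ⊗[ℂ] (Fin 2 → ℂ)) ≃ₗ[ℂ] (Fin 2 → V) :=
  (TensorProduct.congr (LinearEquiv.refl ℂ V) (TensorProduct.lid ℂ (Fin 2 → ℂ))).trans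
    (TensorProduct.piScalarRight ℂ ℂ V (Fin 2))

theorem tensorPairEquiv_tmul (ψ : V) (c : ℂ) (χ : Fin 2 → ℂ) :
    tensorPairEquiv V (ψ ⊗ₜ (c ⊗ₜ χ)) = fun i => (c * χ i) • ψ := by
  funext i
  simp [tensorPairEquiv, mul_smul]

/-- Both sides are additive, so pure tensors suffice. There the charge contributes the scalar `z⁻¹`
and the doublet mixes the two copies of `V` by the matrix of `h`, the form produced on the spinor
side by `diracTen_residual`. -/
theorem tensorPairEquiv_outerTensor (ρ : Representation ℂ G V) (g : G) (z : Circle) (h : SU2)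
    (x : V ⊗[ℂ] (ℂ ⊗[ℂ] (Fin 2 → ℂ))) :
    tensorPairEquiv V (outerTensor ρ (outerTensor (u1Rep (-1)) fund) (g, (z, h)) x) =
      fun i => ρ g (((z⁻¹ : Circle) : ℂ) • ∑ j, h.1 i j • tensorPairEquiv V x j) := by
  induction x using TensorProduct.induction_on with
  | zero => funext i; simp
  | add x y hx hy =>
    rw [map_add, map_add, hx, hy]
    funext i
    simp [Finset.sum_add_distrib, smul_add]
  | tmul ψ y =>
    induction y using TensorProduct.induction_on with
    | zero => funext i; simp
    | add x y hx hy =>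
      rw [TensorProduct.tmul_add, map_add, map_add, hx, hy]
      funext i
      simp [Finset.sum_add_distrib, smul_add]
    | tmul c χ =>
      have h1 : outerTensor ρ (outerTensor (u1Rep (-1)) fund) (g, (z, h)) (ψ ⊗ₜ (c ⊗ₜ χ)) =
          ρ g ψ ⊗ₜ ((((z ^ (-1 : ℤ) : Circle) : ℂ) * c) ⊗ₜ (fund h χ)) := rfl
      have h2 (i : Fin 2) : fund h χ i = ∑ j, h.1 i j * χ j := by
        change Matrix.toLin (Pi.basisFun ℂ (Fin 2)) (Pi.basisFun ℂ (Fin 2)) h.1 χ i = _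
        rw [Matrix.toLin_eq_toLin', Matrix.toLin'_apply]
        rfl
      rw [h1, tensorPairEquiv_tmul, tensorPairEquiv_tmul]
      funext i
      rw [h2, zpow_neg_one]
      simp only [Fin.sum_univ_two, map_smul, map_add]
      module

variable [Module ℝ V] [IsScalarTower ℝ ℂ V]

/-- An isomorphism from `ρ ⊠ 1⁻ ⊠ 2` to a real representation, given by a real linear isomorphism
on pairs. -/
def branchingEquiv (ρ : Representation ℂ G V) (R : Representation ℝ (G × (Circle × SU2)) W)
    (θ : (Fin 2 → V) ≃ₗ[ℝ] W)
    (hθ : ∀ g z (h : SU2) a,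
      θ (fun i => ρ g (((z⁻¹ : Circle) : ℂ) • ∑ j, h.1 i j • a j)) = R (g, (z, h)) (θ a)) :
    (realify (outerTensor ρ (outerTensor (u1Rep (-1)) fund))).Equiv R :=
  Representation.Equiv.mk (((tensorPairEquiv V).restrictScalars ℝ).trans θ) fun x =>
    LinearMap.ext fun v => (congrArg θ (tensorPairEquiv_outerTensor ρ x.1 x.2.1 x.2.2 v)).trans
      (hθ _ _ _ _)

theorem branchingEquiv_tmul (ρ : Representation ℂ G V)
    (R : Representation ℝ (G × (Circle × SU2)) W) (θ : (Fin 2 → V) ≃ₗ[ℝ] W)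
    (hθ : ∀ g z (h : SU2) a,
      θ (fun i => ρ g (((z⁻¹ : Circle) : ℂ) • ∑ j, h.1 i j • a j)) = R (g, (z, h)) (θ a))
    (ψ : V) (k : Fin 2) :
    branchingEquiv ρ R θ hθ (ψ ⊗ₜ[ℂ] ((1 : ℂ) ⊗ₜ[ℂ] (Pi.single k 1 : Fin 2 → ℂ))) =
      θ (Pi.single k ψ) := by
  change θ (tensorPairEquiv V _) = _
  rw [tensorPairEquiv_tmul]
  congr 1
  funext i
  by_cases h : i = k
  · subst h; simp
  · simp [h]

end Branching

/-- The real linear isomorphism from pairs of Weyl spinors to the quaternionic subspace. -/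
def pairToFixed {S : Submodule ℝ (Octonion × Octonion)} (hS : S = LinearMap.range quatToOct) :
    (Fin 2 → Fin 2 → ℂ) ≃ₗ[ℝ] S :=
  (compPairToQuat.trans (LinearEquiv.ofInjective quatToOct quatToOct_injective)).trans
    (LinearEquiv.ofEq _ _ hS.symm)

theorem coe_pairToFixed {S : Submodule ℝ (Octonion × Octonion)}
    (hS : S = LinearMap.range quatToOct) (a : Fin 2 → Fin 2 → ℂ) :
    (pairToFixed hS a : Octonion × Octonion) = quatToOct (compPairToQuat a) :=
  rfl

theorem rep16_residual (g : SpinMink 4) (z : Circle) (h : SU2) (a : Fin 2 → Fin 2 → ℂ) :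
    quatToOct (compPairToQuat fun i => weyl g (((z⁻¹ : Circle) : ℂ) • ∑ j, h.1 i j • a j)) =
      rep16 (fullHom (1, residualHom (g, (z, h)))) (quatToOct (compPairToQuat a)) := by
  have h1 := diracTen_residual g z h a 0
  rw [diracTen_apply] at h1
  exact (congrArg Prod.fst h1).symm

theorem rep16bar_residual (g : SpinMink 4) (z : Circle) (h : SU2) (a : Fin 2 → Fin 2 → ℂ) :
    quatToOct (compPairToQuat fun i => weylBar g (((z⁻¹ : Circle) : ℂ) • ∑ j, h.1 i j • a j)) =
      rep16bar (fullHom (1, residualHom (g, (z, h)))) (quatToOct (compPairToQuat a)) := by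
  have h1 := diracTen_residual g z h 0 a
  rw [diracTen_apply] at h1
  exact (congrArg Prod.snd h1).symm

theorem compPairToQuat_single_zero (ψ : Fin 2 → ℂ) :
    compPairToQuat (Pi.single 0 ψ) = (compQuat 0 (ψ 0), compQuat 0 (ψ 1)) := by
  simp [compPairToQuat]

theorem compPairToQuat_single_one (ψ : Fin 2 → ℂ) :
    compPairToQuat (Pi.single 1 ψ) = -(compQuat (ψ 0) 0, compQuat (ψ 1) 0) := by
  refine Prod.ext ?_ ?_ <;> ext <;> simp [compPairToQuat, compQuat]

/-! ### The branching isomorphisms. -/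

theorem exists_branching16
    {ρ : Representation ℝ (SU2 × (SpinMink 6 × SU2)) (Octonion × Octonion)}
    (hρ : fixedSpace (resZ2A ρ) = LinearMap.range quatToOct)
    {w : Representation ℂ (SpinMink 4) (Fin 2 → ℂ)}
    (hw : ∀ (g : SpinMink 4) (z : Circle) (h : SU2) (a : Fin 2 → Fin 2 → ℂ),
      quatToOct (compPairToQuat fun i => w g (((z⁻¹ : Circle) : ℂ) • ∑ j, h.1 i j • a j)) =
        ρ (1, residualHom (g, (z, h))) (quatToOct (compPairToQuat a))) :
    ∃ Φ : (realify (outerTensor w (outerTensor (u1Rep (-1)) fund))).Equiv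
        ((fixedRep (resZ2A ρ)).comp residualHom),
      ∀ ψ : Fin 2 → ℂ,
        ((Φ (ψ ⊗ₜ[ℂ] ((1 : ℂ) ⊗ₜ[ℂ] (Pi.single 0 1 : Fin 2 → ℂ))) :
            fixedSpace (resZ2A ρ)) : Octonion × Octonion) =
          quatToOct (compQuat 0 (ψ 0), compQuat 0 (ψ 1)) ∧
        ((Φ (ψ ⊗ₜ[ℂ] ((1 : ℂ) ⊗ₜ[ℂ] (Pi.single 1 1 : Fin 2 → ℂ))) :
            fixedSpace (resZ2A ρ)) : Octonion × Octonion) =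
          quatToOct (-(compQuat (ψ 0) 0, compQuat (ψ 1) 0)) := by
  refine ⟨branchingEquiv w _ (pairToFixed hρ) fun g z h a => Subtype.ext (hw g z h a),
    fun ψ => ⟨?_, ?_⟩⟩
  · rw [branchingEquiv_tmul, coe_pairToFixed, compPairToQuat_single_zero]
  · rw [branchingEquiv_tmul, coe_pairToFixed, compPairToQuat_single_one]

theorem fixedSpace_rep16 :
    fixedSpace (resZ2A (rep16.comp fullHom)) = LinearMap.range quatToOct ∧
      fixedSpace (rep16.comp fullHom) = LinearMap.range quatToOct :=
  fixedSpace_eq_range_quatToOct fun g ψ => by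
    rw [MonoidHom.comp_apply]
    exact rep16_fullHom_left g ψ

theorem fixedSpace_rep16bar :
    fixedSpace (resZ2A (rep16bar.comp fullHom)) = LinearMap.range quatToOct ∧
      fixedSpace (rep16bar.comp fullHom) = LinearMap.range quatToOct :=
  fixedSpace_eq_range_quatToOct fun g ψ => by
    rw [MonoidHom.comp_apply]
    exact rep16bar_fullHom_left g ψ

/-- The real linear isomorphism from pairs of Dirac spinors to pairs of quaternionic spinors. -/
def diracPairToFixed {S : Submodule ℝ ((Octonion × Octonion) × (Octonion × Octonion))}
    (hS : S = LinearMap.range (quatToOct.prodMap quatToOct)) :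
    (Fin 2 → (Fin 2 → ℂ) × (Fin 2 → ℂ)) ≃ₗ[ℝ] S :=
  (({ toFun := fun a => (fun i => (a i).1, fun i => (a i).2)
      invFun := fun b i => (b.1 i, b.2 i)
      map_add' := fun _ _ => rfl
      map_smul' := fun _ _ => rfl
      left_inv := fun _ => rfl
      right_inv := fun _ => rfl } :
      (Fin 2 → (Fin 2 → ℂ) × (Fin 2 → ℂ)) ≃ₗ[ℝ] (Fin 2 → Fin 2 → ℂ) × (Fin 2 → Fin 2 → ℂ)).trans
    (compPairToQuat.prodCongr compPairToQuat)).trans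
    ((LinearEquiv.ofInjective (quatToOct.prodMap quatToOct)
      (quatToOct_injective.prodMap quatToOct_injective)).trans (LinearEquiv.ofEq _ _ hS.symm))

theorem coe_diracPairToFixed {S : Submodule ℝ ((Octonion × Octonion) × (Octonion × Octonion))}
    (hS : S = LinearMap.range (quatToOct.prodMap quatToOct))
    (a : Fin 2 → (Fin 2 → ℂ) × (Fin 2 → ℂ)) :
    (diracPairToFixed hS a : (Octonion × Octonion) × (Octonion × Octonion)) =
      (quatToOct (compPairToQuat fun i => (a i).1), quatToOct (compPairToQuat fun i => (a i).2)) :=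
  rfl

/-- The branching of the fixed part of the `32`. -/
def branching32 :
    (realify (outerTensor (weyl.prod weylBar) (outerTensor (u1Rep (-1)) fund))).Equiv
      ((fixedRep (resZ2A ((rep32.comp spin91to101).comp fullHom))).comp residualHom) :=
  branchingEquiv _ _ (diracPairToFixed fixedSpace_rep32.1) fun g z h a => by
    refine Subtype.ext ?_
    -- The target action is again `diracTen` by definition; only the regrouping of a pair of Dirac
    -- spinors into two pairs of Weyl spinors remains.
    refine Eq.trans ?_ (diracTen_residual g z h (fun i => (a i).1) (fun i => (a i).2)).symm
    rw [coe_diracPairToFixed]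
    have h1 (i : Fin 2) : (∑ j, h.1 i j • a j).1 = ∑ j, h.1 i j • (a j).1 := by
      simp
    have h2 (i : Fin 2) : (∑ j, h.1 i j • a j).2 = ∑ j, h.1 i j • (a j).2 := by
      simp
    simp only [← h1, ← h2]
    rfl

end

theorem theorem3p1 :
    -- the `SU(2)_L`-fixed part of `∧²4` is spanned by `½ e₆∧e_I - ½ ∑_{J<K} ε^{IJK} e_J∧e_K`
    fixedSpace (wedgeRep 2 rep4) = Submodule.span ℝ
      {(1 / 2 : ℝ) • wedge2 0 1 - (1 / 2 : ℝ) • wedge2 2 3,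
        (1 / 2 : ℝ) • wedge2 0 2 - (1 / 2 : ℝ) • wedge2 3 1,
        (1 / 2 : ℝ) • wedge2 0 3 - (1 / 2 : ℝ) • wedge2 1 2} ∧
    -- and it is the `3` of `SU(2)_R`
    Nonempty ((fixedRep (wedgeRep 2 rep4)).Equiv adj3) ∧
    -- neither `ℤ₂^A` nor `SU(2)_L` fixes a nonzero vector of `∧¹4` or `∧³4`
    fixedSpace (resZ2A (wedgeRep 1 rep4)) = ⊥ ∧
    fixedSpace (resZ2A (wedgeRep 3 rep4)) = ⊥ ∧
    fixedSpace (wedgeRep 1 rep4) = ⊥ ∧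
    fixedSpace (wedgeRep 3 rep4) = ⊥ ∧
    -- the `ℤ₂^A`-fixed part of `16` is `ℍ² ⊂ 𝕆²` and is fixed by `SU(2)_L`;
    -- as a representation of `Spin(5,1)` it is `8`
    fixedSpace (resZ2A (rep16.comp fullHom)) = LinearMap.range quatToOct ∧
    fixedSpace (rep16.comp fullHom) = LinearMap.range quatToOct ∧
    (∀ (g : SpinMink 6) (ψ : Quaternion ℝ × Quaternion ℝ),
      quatToOct (rep8 g ψ) = rep16 (fullHom (1, (g, 1))) (quatToOct ψ)) ∧
    -- it branches as `2 ⊠ 1⁻ ⊠ 2`, compatibly with `ℍ² = ℂ²j ⊕ ℂ²`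
    (∃ Φ : (realify (outerTensor weyl (outerTensor (u1Rep (-1)) fund))).Equiv
        ((fixedRep (resZ2A (rep16.comp fullHom))).comp residualHom),
      ∀ ψ : Fin 2 → ℂ,
        ((Φ (ψ ⊗ₜ[ℂ] ((1 : ℂ) ⊗ₜ[ℂ] (Pi.single 0 1 : Fin 2 → ℂ))) :
            fixedSpace (resZ2A (rep16.comp fullHom))) : Octonion × Octonion) =
          quatToOct (compQuat 0 (ψ 0), compQuat 0 (ψ 1)) ∧
        ((Φ (ψ ⊗ₜ[ℂ] ((1 : ℂ) ⊗ₜ[ℂ] (Pi.single 1 1 : Fin 2 → ℂ))) :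
            fixedSpace (resZ2A (rep16.comp fullHom))) : Octonion × Octonion) =
          quatToOct (-(compQuat (ψ 0) 0, compQuat (ψ 1) 0))) ∧
    -- the same for the conjugate representations
    fixedSpace (resZ2A (rep16bar.comp fullHom)) = LinearMap.range quatToOct ∧
    fixedSpace (rep16bar.comp fullHom) = LinearMap.range quatToOct ∧
    (∀ (g : SpinMink 6) (ψ : Quaternion ℝ × Quaternion ℝ),
      quatToOct (rep8bar g ψ) = rep16bar (fullHom (1, (g, 1))) (quatToOct ψ)) ∧
    (∃ Φ : (realify (outerTensor weylBar (outerTensor (u1Rep (-1)) fund))).Equiv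
        ((fixedRep (resZ2A (rep16bar.comp fullHom))).comp residualHom),
      ∀ ψ : Fin 2 → ℂ,
        ((Φ (ψ ⊗ₜ[ℂ] ((1 : ℂ) ⊗ₜ[ℂ] (Pi.single 0 1 : Fin 2 → ℂ))) :
            fixedSpace (resZ2A (rep16bar.comp fullHom))) : Octonion × Octonion) =
          quatToOct (compQuat 0 (ψ 0), compQuat 0 (ψ 1)) ∧
        ((Φ (ψ ⊗ₜ[ℂ] ((1 : ℂ) ⊗ₜ[ℂ] (Pi.single 1 1 : Fin 2 → ℂ))) :
            fixedSpace (resZ2A (rep16bar.comp fullHom))) : Octonion × Octonion) =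
          quatToOct (-(compQuat (ψ 0) 0, compQuat (ψ 1) 0))) ∧
    -- the fixed part of `32`
    fixedSpace (resZ2A ((rep32.comp spin91to101).comp fullHom)) =
      fixedSpace ((rep32.comp spin91to101).comp fullHom) ∧
    Nonempty ((realify (outerTensor (weyl.prod weylBar) (outerTensor (u1Rep (-1)) fund))).Equiv
      ((fixedRep (resZ2A ((rep32.comp spin91to101).comp fullHom))).comp residualHom)) := by
  refine ⟨fixedSpace_wedge2, ⟨fixedWedgeEquiv⟩, fixedSpace_resZ2A_wedge_odd (by decide),
    fixedSpace_resZ2A_wedge_odd (by decide), fixedSpace_wedge_odd (by decide),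
    fixedSpace_wedge_odd (by decide), fixedSpace_rep16.1, fixedSpace_rep16.2, rep16_quatToOct, ?_,
    fixedSpace_rep16bar.1, fixedSpace_rep16bar.2, rep16bar_quatToOct, ?_,
    fixedSpace_rep32.1.trans fixedSpace_rep32.2.symm, ⟨branching32⟩⟩
  · exact exists_branching16 fixedSpace_rep16.1 rep16_residual
  · exact exists_branching16 fixedSpace_rep16bar.1 rep16bar_residual
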